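/- **Proposition 6.1.** Let $\mathfrak g$ be a finite-dimensional simple complex Lie algebra, with a fixed Cartan subalgebra $\mathfrak h$ and a fixed base of its root system $\Phi\subset\mathfrak h^*$. Order the roots by $\alpha\le\beta$ if and only if $\beta-\alpha$ is a sum of (zero or more, possibly repeated) simple roots. A root is *long* if its length, with respect to a Weyl-invariant inner product, is maximal among all roots (so all roots are long in the simply laced case). Let $k\ge 1$ and let $\beta_1,\dots,\beta_k\in\Phi$ be such that * $\beta_1=\alpha_0$ is the highest root; * for $1\le i<k$, $\beta_{i+1}$ is a highest long root orthogonal to $\beta_1,\dots,\beta_i$, that is, a maximal element, for the order above, of the set of long roots orthogonal to $\beta_1,\dots,\beta_i$ (there may be several such elements, and any of them is allowed). Put $\sigma_i=\beta_1+\cdots+\beta_i$. If $\sigma_i$ is a dominant weight for every $1\le i\le k$, then $\sigma_k$ is the highest weight of an irreducible component of $S^k\mathfrak g$: the $k$-th symmetric power $S^k\mathfrak g$ of the adjoint representation contains an irreducible $\mathfrak g$-submodule $W$ with highest weight $\sigma_k$, i.e. an irreducible submodule $W$ containing a nonzero vector of weight $\sigma_k$ that is annihilated by all positive root spaces. -/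

import Mathlib

namespace SymLie

/-- The algebra map from the symmetric algebra of `M` to its dual numbers extending
`x ↦ x + ε f(x)`; its `ε`-component is the derivation extending `f`. -/
noncomputable def symAux {R M : Type*} [CommRing R] [AddCommGroup M] [Module R M]
    (f : M →ₗ[R] M) :
    SymmetricAlgebra R M →ₐ[R] TrivSqZeroExt (SymmetricAlgebra R M) (SymmetricAlgebra R M) :=
  SymmetricAlgebra.lift
    ((TrivSqZeroExt.inlAlgHom R (SymmetricAlgebra R M) (SymmetricAlgebra R M)).toLinearMap ∘ₗ
        SymmetricAlgebra.ι R M +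
      ((TrivSqZeroExt.inrHom (SymmetricAlgebra R M) (SymmetricAlgebra R M)).restrictScalars R) ∘ₗ
        SymmetricAlgebra.ι R M ∘ₗ f)

theorem symAux_ι {R M : Type*} [CommRing R] [AddCommGroup M] [Module R M]
    (f : M →ₗ[R] M) (x : M) :
    symAux f (SymmetricAlgebra.ι R M x) =
      TrivSqZeroExt.inl (SymmetricAlgebra.ι R M x) +
        TrivSqZeroExt.inr (SymmetricAlgebra.ι R M (f x)) := by
  simp [symAux]

theorem fst_symAux {R M : Type*} [CommRing R] [AddCommGroup M] [Module R M]
    (f : M →ₗ[R] M) (a : SymmetricAlgebra R M) : (symAux f a).fst = a := by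
  have h : (TrivSqZeroExt.fstHom R (SymmetricAlgebra R M) (SymmetricAlgebra R M)).comp (symAux f)
      = AlgHom.id R (SymmetricAlgebra R M) := by
    apply SymmetricAlgebra.algHom_ext
    ext x
    simp [symAux_ι]
  exact DFunLike.congr_fun h a

/-- The derivation of the symmetric algebra of `M` that extends the linear map `f : M → M`. -/
noncomputable def symDer {R M : Type*} [CommRing R] [AddCommGroup M] [Module R M]
    (f : M →ₗ[R] M) : Derivation R (SymmetricAlgebra R M) (SymmetricAlgebra R M) :=
  Derivation.mk'
    { toFun := fun a => (symAux f a).snd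
      map_add' := by simp
      map_smul' := by simp }
    (by intro a b; simp [fst_symAux, mul_comm])

theorem symDer_ι {R M : Type*} [CommRing R] [AddCommGroup M] [Module R M]
    (f : M →ₗ[R] M) (x : M) :
    symDer f (SymmetricAlgebra.ι R M x) = SymmetricAlgebra.ι R M (f x) := by
  change (symAux f _).snd = _
  simp [symAux_ι]

theorem derivation_ext {R M : Type*} [CommRing R] [AddCommGroup M] [Module R M]
    {D E : Derivation R (SymmetricAlgebra R M) (SymmetricAlgebra R M)}
    (h : ∀ x, D (SymmetricAlgebra.ι R M x) = E (SymmetricAlgebra.ι R M x)) : D = E := by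
  ext a
  induction a using SymmetricAlgebra.induction with
  | algebraMap r => simp
  | ι x => exact h x
  | mul a b ha hb => simp [ha, hb]
  | add a b ha hb => simp [ha, hb]

/-- The Lie algebra homomorphism `L → Der (S M)` induced by a representation `M` of `L`. -/
noncomputable def symHom (R L M : Type*) [CommRing R] [LieRing L] [LieAlgebra R L]
    [AddCommGroup M] [Module R M] [LieRingModule L M] [LieModule R L M] :
    L →ₗ⁅R⁆ Derivation R (SymmetricAlgebra R M) (SymmetricAlgebra R M) where
  toFun x := symDer (LieModule.toEnd R L M x)
  map_add' x y := derivation_ext fun m => by simp [symDer_ι]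
  map_smul' r x := derivation_ext fun m => by simp [symDer_ι]
  map_lie' {x y} := derivation_ext fun m => by
    simp [symDer_ι, Derivation.commutator_apply]

/-- `L` acts on the symmetric algebra of a representation `M` by derivations. -/
noncomputable instance instLieRingModule {R L M : Type*} [CommRing R] [LieRing L] [LieAlgebra R L]
    [AddCommGroup M] [Module R M] [LieRingModule L M] [LieModule R L M] :
    LieRingModule L (SymmetricAlgebra R M) :=
  LieRingModule.compLieHom (SymmetricAlgebra R M) (symHom R L M)

instance instLieModule {R L M : Type*} [CommRing R] [LieRing L] [LieAlgebra R L]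
    [AddCommGroup M] [Module R M] [LieRingModule L M] [LieModule R L M] :
    LieModule R L (SymmetricAlgebra R M) :=
  LieModule.compLieHom (SymmetricAlgebra R M) (symHom R L M)

theorem lie_ι {R L M : Type*} [CommRing R] [LieRing L] [LieAlgebra R L]
    [AddCommGroup M] [Module R M] [LieRingModule L M] [LieModule R L M] (x : L) (m : M) :
    ⁅x, SymmetricAlgebra.ι R M m⁆ = SymmetricAlgebra.ι R M ⁅x, m⁆ :=
  symDer_ι (LieModule.toEnd R L M x) m

theorem lie_mul {R L M : Type*} [CommRing R] [LieRing L] [LieAlgebra R L]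
    [AddCommGroup M] [Module R M] [LieRingModule L M] [LieModule R L M] (x : L)
    (a b : SymmetricAlgebra R M) : ⁅x, a * b⁆ = ⁅x, a⁆ * b + a * ⁅x, b⁆ := by
  have h := (symHom R L M x).leibniz a b
  change symHom R L M x (a * b) = symHom R L M x a * b + a * symHom R L M x b
  rw [h, smul_eq_mul, smul_eq_mul]
  ring

theorem lie_one {R L M : Type*} [CommRing R] [LieRing L] [LieAlgebra R L]
    [AddCommGroup M] [Module R M] [LieRingModule L M] [LieModule R L M] (x : L) :
    ⁅x, (1 : SymmetricAlgebra R M)⁆ = 0 :=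
  (symHom R L M x).map_one_eq_zero

/-- The `k`-th symmetric power `S^k M` of a representation `M` of `L`: the homogeneous component of
degree `k` of the symmetric algebra, spanned by the products of `k` elements of `M`, with
`x ∈ L` acting by `x • (m₁ ⋯ m_k) = ∑ i, m₁ ⋯ (x • m_i) ⋯ m_k`. -/
noncomputable def symPow (R L M : Type*) [CommRing R] [LieRing L] [LieAlgebra R L]
    [AddCommGroup M] [Module R M] [LieRingModule L M] [LieModule R L M] (k : ℕ) :
    LieSubmodule R L (SymmetricAlgebra R M) where
  __ := LinearMap.range (SymmetricAlgebra.ι R M) ^ k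
  lie_mem {x m} hm := by
    change m ∈ LinearMap.range (SymmetricAlgebra.ι R M) ^ k at hm
    change ⁅x, m⁆ ∈ LinearMap.range (SymmetricAlgebra.ι R M) ^ k
    induction k generalizing m with
    | zero =>
      rw [pow_zero] at hm
      obtain ⟨r, rfl⟩ := Submodule.mem_one.1 hm
      have h : ⁅x, algebraMap R (SymmetricAlgebra R M) r⁆ = 0 := (symHom R L M x).map_algebraMap r
      rw [h]
      exact Submodule.zero_mem _
    | succ k ih =>
      rw [pow_succ] at hm ⊢
      induction hm using Submodule.mul_induction_on' with
      | mem_mul_mem a ha b hb =>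
        rw [lie_mul]
        refine Submodule.add_mem _ (Submodule.mul_mem_mul (ih ha) hb)
          (Submodule.mul_mem_mul ha ?_)
        obtain ⟨y, rfl⟩ := hb
        exact ⟨⁅x, y⁆, (lie_ι x y).symm⟩
      | add a _ b _ ha hb =>
        rw [lie_add]
        exact Submodule.add_mem _ ha hb

section Roots

variable {ι R M N : Type*} [CommRing R] [AddCommGroup M] [Module R M] [AddCommGroup N] [Module R N]

/-- The usual partial order on roots: `α ≤ β` if `β - α` is a sum of simple roots. -/
def RootLE {P : RootPairing ι R M N} (b : P.Base) (α β : ι) : Prop :=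
  P.root β - P.root α ∈ AddSubmonoid.closure (P.root '' (b.support : Set ι))

/-- `α` is the highest root. -/
def IsHighestRoot {P : RootPairing ι R M N} (b : P.Base) (α : ι) : Prop :=
  ∀ β, RootLE b β α

/-- `α` is a long root: no root has a greater length with respect to the canonical (positive
definite, Weyl group invariant) form. If all roots have the same length, all of them are long. -/
def IsLongRoot [Fintype ι] [CharZero R] [IsDomain R] (P : RootPairing ι R M N)
    [P.IsCrystallographic] (α : ι) : Prop :=
  ∀ β, (P.posRootForm ℤ).rootLength β ≤ (P.posRootForm ℤ).rootLength α

/-- `α` is a highest long root orthogonal to the roots in `S`: it is a maximal element, for the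
partial order on roots, of the set of long roots orthogonal to all roots in `S`. -/
def IsHighestLongRootOrthogonalTo [Fintype ι] [CharZero R] [IsDomain R] {P : RootPairing ι R M N}
    [P.IsCrystallographic] (b : P.Base) (S : Set ι) (α : ι) : Prop :=
  IsLongRoot P α ∧ (∀ γ ∈ S, P.IsOrthogonal α γ) ∧
    ∀ β, IsLongRoot P β → (∀ γ ∈ S, P.IsOrthogonal β γ) → RootLE b α β → β = α

/-- `μ` is a dominant (integral) weight. -/
def IsDominant {P : RootPairing ι R M N} (b : P.Base) (μ : M) : Prop :=
  ∀ i ∈ b.support, ∃ n : ℕ, P.toLinearMap μ (P.coroot i) = n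

end Roots

section HighestWeight

open LieAlgebra LieAlgebra.IsKilling

variable {K L : Type*} [Field K] [CharZero K] [LieRing L] [LieAlgebra K L] [FiniteDimensional K L]
  [IsKilling K L] {H : LieSubalgebra K L} [H.IsCartanSubalgebra]
  [LieModule.IsTriangularizable K H L]
  {V : Type*} [AddCommGroup V] [Module K V] [LieRingModule L V] [LieModule K L V]

/-- `v` is a highest weight vector of weight `μ`: it is nonzero, the Cartan subalgebra acts on it
through `μ`, and it is annihilated by all positive root spaces. -/
structure IsHighestWeightVector (b : (rootSystem H).Base) (μ : Module.Dual K H) (v : V) :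
    Prop where
  ne_zero : v ≠ 0
  lie_cartan : ∀ h : H, ⁅(h : L), v⁆ = μ h • v
  lie_pos : ∀ α : H.root, b.IsPos α → ∀ x ∈ rootSpace H α.1, ⁅x, v⁆ = 0

/-- `W` is an irreducible subrepresentation of `V` with highest weight `μ`. -/
def IsIrreducibleWithHighestWeight (b : (rootSystem H).Base) (W : LieSubmodule K L V)
    (μ : Module.Dual K H) : Prop :=
  LieModule.IsIrreducible K L W ∧ ∃ v ∈ W, IsHighestWeightVector b μ v

end HighestWeight

end SymLie

set_option linter.unusedSectionVars false

/-! Let `s = {1, …, j}` and let `h` be the sum of the coroots of `β i`, `i ∈ s`. The `β i` are long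
and pairwise orthogonal, so they all have the same length. Dominance of the sum `σ` of the `β i`
therefore says that positive roots have nonnegative `h`-degree. The highest root has degree 2, so
all degrees lie between -2 and 2: `L = L₋₂ ⊕ L₋₁ ⊕ L₀ ⊕ L₁ ⊕ L₂`. Positive root vectors of positive
degree kill `L₂`, hence also the symmetric algebra of `L₂`. A highest weight vector of weight `σ`
can thus be sought in `Sʲ L₂`, as a vector on which `L₀` acts through the character given by `σ`.
The model is the determinant of a block of a matrix, and the construction imitates Laplace
expansion.

Suppose `F` is such a vector for `s`, and add an index `k`; the grading is now that of `insert k s`.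
Twist `S L` by the character `-σ` of `L₀`, with `σ` the new sum. Then `F` and the root vector `v (β
k)` of `L₋₂` are both highest weight vectors for `L₀`, of the same weight `-β k`. The `L₀`-module
generated by the pair `(v (β k), F)` is the graph of an equivariant map `φ : L₋₂ → Sʲ L₂`, the
analogue of taking cofactors. It is single-valued because a highest weight vector generates an
irreducible `L`-module (`eq_zero_of_mem_pairSpan`). It is defined on all of `L₋₂` because `L₋₂` is
irreducible over `L₀`, a consequence of the simplicity of `L` (`mem_of_mem_bottomSpace`).
Contracting `φ` with the canonical element of `L₂ ⊗ L₋₂` gives the new `F'`, of degree one higher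
and with the required semi-invariance.

It remains to see that `F' ≠ 0`. View `S L` as functions on `L` through the Killing form and
evaluate at `E`, the sum of the `v (β i)`. The value of `F'` is the sum over `i` of the values of `φ
(v (β i))`, and the term `i = k` is the nonzero value of `F` at the previous point. All terms are
equal: if a root of degree 2 pairs to 1 with both `β i` and `β j`, an element of `L₀` that fixes `E`
identifies the two terms (`IsTwistedEquivariant.evalAt_eq`), and irreducibility of `L₋₂` makes this
relation connect all indices (`eq_of_forall_connected`). Hence the value is a positive multiple of a
nonzero number.

The highest weight theory used here comes from the Casimir operator. Its eigenvalue separates two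
dominant weights whose difference is a sum of simple roots, so in a finite-dimensional module the
submodule generated by a highest weight vector has no other highest weight vectors up to scalars. -/

namespace SymLie

open RootPairing

/-! ### Lengths and pairings of long roots -/

section LongRoots

variable {ι R M N : Type*} [Fintype ι] [CommRing R] [CharZero R] [IsDomain R] [AddCommGroup M]
  [Module R M] [AddCommGroup N] [Module R N] {P : RootPairing ι R M N} [P.IsCrystallographic]

theorem IsLongRoot.pairingIn_mem {β : ι} (hβ : IsLongRoot P β) {γ : ι}
    (h : P.root γ ≠ P.root β) (h' : P.root γ ≠ -P.root β) :
    P.pairingIn ℤ γ β = -1 ∨ P.pairingIn ℤ γ β = 0 ∨ P.pairingIn ℤ γ β = 1 := by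
  by_contra hc
  have := (P.posRootForm ℤ).rootLength_lt_of_pairingIn_notMem h h' (by simpa using hc)
  exact absurd (hβ γ) (not_le.2 this)

theorem IsLongRoot.rootLength_eq {β β' : ι} (hβ : IsLongRoot P β) (hβ' : IsLongRoot P β') :
    (P.posRootForm ℤ).rootLength β = (P.posRootForm ℤ).rootLength β' :=
  le_antisymm (hβ' β) (hβ β')

theorem rootLength_reflectionPerm (B : P.RootPositiveForm ℤ) (i j : ι) :
    B.rootLength (P.reflectionPerm i j) = B.rootLength j := by
  apply FaithfulSMul.algebraMap_injective ℤ R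
  rw [B.algebraMap_rootLength, B.algebraMap_rootLength, P.root_reflectionPerm]
  exact B.isOrthogonal_reflection i _ _

theorem pairingIn_eq_of_root_eq_add {a c d : ι} (h : P.root d = P.root a + P.root c) (i : ι) :
    P.pairingIn ℤ d i = P.pairingIn ℤ a i + P.pairingIn ℤ c i := by
  apply FaithfulSMul.algebraMap_injective ℤ R
  simp only [map_add, P.algebraMap_pairingIn, ← P.root_coroot_eq_pairing, h, LinearMap.add_apply]

theorem pairingIn_eq_of_root_eq_sub {a c d : ι} (h : P.root d = P.root a - P.root c) (i : ι) :
    P.pairingIn ℤ d i = P.pairingIn ℤ a i - P.pairingIn ℤ c i := by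
  apply FaithfulSMul.algebraMap_injective ℤ R
  simp only [map_sub, P.algebraMap_pairingIn, ← P.root_coroot_eq_pairing, h, LinearMap.sub_apply]

theorem pairingIn_eq_of_root_eq_neg {a d : ι} (h : P.root d = -P.root a) (i : ι) :
    P.pairingIn ℤ d i = -P.pairingIn ℤ a i := by
  apply FaithfulSMul.algebraMap_injective ℤ R
  simp only [map_neg, P.algebraMap_pairingIn, ← P.root_coroot_eq_pairing, h, LinearMap.neg_apply]

theorem intCast_pairingIn (i j : ι) : (P.pairingIn ℤ i j : R) = P.pairing i j :=
  P.algebraMap_pairingIn ℤ i j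

theorem IsOrthogonal.pairingIn_eq_zero {i j : ι} (h : P.IsOrthogonal i j) :
    P.pairingIn ℤ i j = 0 := by
  apply FaithfulSMul.algebraMap_injective ℤ R
  simpa [intCast_pairingIn] using h.1

/-- In every Weyl group orbit there is a dominant root. -/
theorem exists_rootLength_eq_forall_pairingIn_nonneg (b : P.Base) (γ : ι) :
    ∃ δ, (P.posRootForm ℤ).rootLength δ = (P.posRootForm ℤ).rootLength γ ∧
      ∀ i ∈ b.support, 0 ≤ P.pairingIn ℤ δ i := by
  -- Among the roots of the same length as `γ`, take one of maximal height: a simple reflection at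
  -- which it paired negatively would raise the height.
  obtain ⟨δ, hδ, hmax⟩ := Set.exists_max_image
    {δ | (P.posRootForm ℤ).rootLength δ = (P.posRootForm ℤ).rootLength γ} b.height
    (Set.toFinite _) ⟨γ, rfl⟩
  refine ⟨δ, hδ, fun i hi => ?_⟩
  by_contra! hneg
  have h1 := hmax (P.reflectionPerm i δ) ((rootLength_reflectionPerm _ i δ).trans hδ)
  have h2 : P.root (P.reflectionPerm i δ) = P.root δ + (-P.pairingIn ℤ δ i) • P.root i := by
    rw [P.root_reflectionPerm, P.reflection_apply_root, ← P.algebraMap_pairingIn ℤ, sub_eq_add_neg,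
      neg_smul, algebraMap_smul]
  rw [b.height_add_zsmul h2, Base.height_one_of_mem_support hi] at h1
  simp at h1
  lia

/-- Nonnegativity is phrased through natural numbers because `R` carries no order. The factor 2
gives integers: twice the product of `γ` with a simple root is their pairing times the squared
length of the simple root. -/
theorem exists_two_mul_form_eq_natCast (b : P.Base) {γ : ι}
    (hγ : ∀ i ∈ b.support, 0 ≤ P.pairingIn ℤ γ i) {x : M}
    (hx : x ∈ AddSubmonoid.closure (P.root '' (b.support : Set ι))) :
    ∃ n : ℕ, 2 * (P.posRootForm ℤ).form (P.root γ) x = n := by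
  induction hx using AddSubmonoid.closure_induction with
  | mem x hx =>
    obtain ⟨i, hi, rfl⟩ := hx
    refine ⟨(P.pairingIn ℤ γ i * (P.posRootForm ℤ).rootLength i).toNat, ?_⟩
    rw [(P.posRootForm ℤ).two_mul_apply_root_root, ← (P.posRootForm ℤ).algebraMap_rootLength,
      ← P.algebraMap_pairingIn ℤ, ← map_mul]
    have := mul_nonneg (hγ i hi) ((P.posRootForm ℤ).rootLength_pos i).le
    obtain ⟨n, hn⟩ := Int.eq_ofNat_of_zero_le this
    rw [hn]; simp
  | zero => exact ⟨0, by simp⟩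
  | add x y _ _ hx hy =>
    obtain ⟨n, hn⟩ := hx
    obtain ⟨m, hm⟩ := hy
    exact ⟨n + m, by rw [map_add, mul_add, hn, hm]; simp⟩

/-- Any length is attained by a dominant root `δ`. Both `α` and `δ` have nonnegative product with `α
- δ`, and the two products add up to `(α, α) - (δ, δ)`. -/
theorem IsHighestRoot.isLongRoot {b : P.Base} {α : ι} (h : IsHighestRoot b α)
    (hα : ∀ i ∈ b.support, 0 ≤ P.pairingIn ℤ α i) : IsLongRoot P α := by
  intro γ
  obtain ⟨δ, hδ, hdom⟩ := exists_rootLength_eq_forall_pairingIn_nonneg b γ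
  obtain ⟨n, hn⟩ := exists_two_mul_form_eq_natCast b hα (h δ)
  obtain ⟨m, hm⟩ := exists_two_mul_form_eq_natCast b hdom (h δ)
  rw [← hδ]
  have key : 2 * ((P.posRootForm ℤ).rootLength α - (P.posRootForm ℤ).rootLength δ) =
      ((n + m : ℕ) : ℤ) := by
    apply FaithfulSMul.algebraMap_injective ℤ R
    have hs := (P.posRootForm ℤ).symm.eq (P.root α) (P.root δ)
    simp only [RingHom.id_apply] at hs
    rw [map_mul, map_sub, (P.posRootForm ℤ).algebraMap_rootLength,
      (P.posRootForm ℤ).algebraMap_rootLength]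
    simp only [map_sub] at hn hm
    rw [map_natCast, Nat.cast_add, ← hn, ← hm, map_ofNat, hs]
    ring
  lia

end LongRoots

/-! ### The grading by a sum of coroots of orthogonal long roots -/

section Degree

variable {ι R M N : Type*} [Fintype ι] [CommRing R] [CharZero R] [IsDomain R] [AddCommGroup M]
  [Module R M] [AddCommGroup N] [Module R N] {P : RootPairing ι R M N} [P.IsCrystallographic]

/-- The pairing of the root `γ` with the sum of the coroots of `β i`, `i ∈ s`. -/
noncomputable def cascadeDegree (P : RootPairing ι R M N) [P.IsCrystallographic] (β : ℕ → ι) (s : Finset ℕ)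
    (γ : ι) : ℤ :=
  ∑ i ∈ s, P.pairingIn ℤ γ (β i)

/-- The roots `β i` for `i ∈ s` are long and pairwise orthogonal. -/
structure IsLongOrthogonal (P : RootPairing ι R M N) [P.IsCrystallographic] (β : ℕ → ι)
    (s : Finset ℕ) : Prop where
  long : ∀ i ∈ s, IsLongRoot P (β i)
  orthogonal : ∀ i ∈ s, ∀ j ∈ s, i ≠ j → P.pairingIn ℤ (β i) (β j) = 0

variable {β : ℕ → ι} {s : Finset ℕ}

theorem cascadeDegree_add {a c d : ι} (h : P.root d = P.root a + P.root c) :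
    cascadeDegree P β s d = cascadeDegree P β s a + cascadeDegree P β s c := by
  simp only [cascadeDegree, ← Finset.sum_add_distrib, pairingIn_eq_of_root_eq_add h]

theorem cascadeDegree_sub {a c d : ι} (h : P.root d = P.root a - P.root c) :
    cascadeDegree P β s d = cascadeDegree P β s a - cascadeDegree P β s c := by
  simp only [cascadeDegree, ← Finset.sum_sub_distrib, pairingIn_eq_of_root_eq_sub h]

theorem cascadeDegree_neg {a d : ι} (h : P.root d = -P.root a) :
    cascadeDegree P β s d = -cascadeDegree P β s a := by
  simp only [cascadeDegree, ← Finset.sum_neg_distrib, pairingIn_eq_of_root_eq_neg h]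

namespace IsLongOrthogonal

variable (hs : IsLongOrthogonal P β s)
include hs

theorem mono {t : Finset ℕ} (ht : t ⊆ s) : IsLongOrthogonal P β t :=
  ⟨fun i hi => hs.long i (ht hi), fun i hi j hj => hs.orthogonal i (ht hi) j (ht hj)⟩

theorem sum_pairingIn_self {t : Finset ℕ} (ht : t ⊆ s) {i : ℕ} (hi : i ∈ s) :
    ∑ j ∈ t, P.pairingIn ℤ (β i) (β j) = if i ∈ t then 2 else 0 := by
  have : ∀ j ∈ t, P.pairingIn ℤ (β i) (β j) = if j = i then 2 else 0 := by
    intro j hj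
    split_ifs with h
    · subst h; simp
    · exact hs.orthogonal i hi j (ht hj) (Ne.symm h)
  rw [Finset.sum_congr rfl this, Finset.sum_ite_eq' t i]

theorem cascadeDegree_self {i : ℕ} (hi : i ∈ s) : cascadeDegree P β s (β i) = 2 := by
  rw [cascadeDegree, hs.sum_pairingIn_self subset_rfl hi, if_pos hi]

theorem root_sub_root_notMem {i j : ℕ} (hi : i ∈ s) (hj : j ∈ s) (hij : i ≠ j) :
    P.root (β i) - P.root (β j) ∉ Set.range P.root := by
  rintro ⟨ε, hε⟩
  have h := pairingIn_eq_of_root_eq_sub hε (β i)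
  rw [hs.orthogonal j hj i hi hij.symm] at h
  simp only [P.pairingIn_same, sub_zero] at h
  have h1 : P.root ε ≠ P.root (β i) := by
    intro h'
    rw [h'] at hε
    exact P.ne_zero (β j) (by simpa [eq_comm (a := P.root (β _)), sub_eq_self] using hε)
  have h2 : P.root ε ≠ -P.root (β i) := by
    intro h'
    have := pairingIn_eq_of_root_eq_neg h' (β i)
    simp at this; lia
  rcases (hs.long i hi).pairingIn_mem h1 h2 with h | h | h <;> lia

/-- If the pairing were negative, `γ + β i` would be a root of degree 4. -/
theorem pairingIn_nonneg (hd : ∀ γ, cascadeDegree P β s γ ≤ 2) {γ : ι}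
    (hγ : cascadeDegree P β s γ = 2) {i : ℕ} (hi : i ∈ s) : 0 ≤ P.pairingIn ℤ γ (β i) := by
  by_contra! hneg
  have h' : P.root γ ≠ -P.root (β i) := by
    intro h
    have := cascadeDegree_neg (β := β) (s := s) h
    rw [hs.cascadeDegree_self hi] at this
    lia
  obtain ⟨ε, hε⟩ := P.root_add_root_mem_of_pairingIn_neg hneg h'
  have := hd ε
  rw [cascadeDegree_add hε, hs.cascadeDegree_self hi] at this
  lia

theorem pairingIn_mem_of_cascadeDegree_eq_zero {γ : ι} (hγ : cascadeDegree P β s γ = 0) {i : ℕ}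
    (hi : i ∈ s) :
    P.pairingIn ℤ γ (β i) = -1 ∨ P.pairingIn ℤ γ (β i) = 0 ∨ P.pairingIn ℤ γ (β i) = 1 := by
  apply (hs.long i hi).pairingIn_mem
  · intro h
    have := P.root.injective h
    subst this
    rw [hs.cascadeDegree_self hi] at hγ
    lia
  · intro h
    have := cascadeDegree_neg (β := β) (s := s) h
    rw [hs.cascadeDegree_self hi] at this
    lia

/-- The witness is `δ = β i - γ`, a root of degree 2. It pairs nonnegatively with every `β l`, so
`γ` pairs nonpositively with `β l` for `l ≠ i`. These pairings sum to -1, so exactly one of them is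
-1 and the others vanish. -/
theorem exists_pairingIn_eq_neg_one (hd : ∀ γ, cascadeDegree P β s γ ≤ 2) {γ : ι}
    (hγ : cascadeDegree P β s γ = 0) {i : ℕ} (hi : i ∈ s) (h1 : P.pairingIn ℤ γ (β i) = 1) :
    ∃ j ∈ s, j ≠ i ∧ P.pairingIn ℤ γ (β j) = -1 ∧
      (∀ l ∈ s, l ≠ i → l ≠ j → P.pairingIn ℤ γ (β l) = 0) ∧
      ∃ δ, P.pairingIn ℤ δ (β i) = 1 ∧ P.pairingIn ℤ δ (β j) = 1 ∧ cascadeDegree P β s δ = 2 := by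
  have hne : γ ≠ β i := by
    rintro rfl
    simp at h1
  obtain ⟨δ', hδ'⟩ := P.root_sub_root_mem_of_pairingIn_pos (by lia) hne
  let := P.indexNeg
  have hδ : P.root (-δ') = P.root (β i) - P.root γ := by
    rw [P.indexNeg_neg, P.root_reflectionPerm, P.reflection_apply_self, hδ', neg_sub]
  have hdδ := cascadeDegree_sub (β := β) (s := s) hδ
  rw [hs.cascadeDegree_self hi, hγ] at hdδ
  have hle : ∀ l ∈ s, l ≠ i → P.pairingIn ℤ γ (β l) ≤ 0 := by
    intro l hl hli
    have h3 := hs.pairingIn_nonneg hd hdδ hl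
    rw [pairingIn_eq_of_root_eq_sub hδ, hs.orthogonal i hi l hl hli.symm] at h3
    lia
  have hsum : ∑ l ∈ s.erase i, P.pairingIn ℤ γ (β l) = -1 := by
    have := Finset.add_sum_erase s (fun l => P.pairingIn ℤ γ (β l)) hi
    simp only [cascadeDegree] at hγ
    lia
  obtain ⟨j, hj, hj0⟩ : ∃ j ∈ s.erase i, P.pairingIn ℤ γ (β j) ≠ 0 := by
    by_contra! hc
    rw [Finset.sum_eq_zero hc] at hsum
    lia
  obtain ⟨hji, hjs⟩ := Finset.mem_erase.1 hj
  have hj1 : P.pairingIn ℤ γ (β j) = -1 := by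
    have := hle j hjs hji
    rcases hs.pairingIn_mem_of_cascadeDegree_eq_zero hγ hjs with h | h | h <;> lia
  refine ⟨j, hjs, hji, hj1, fun l hl hli hlj => ?_, -δ', ?_, ?_, hdδ⟩
  · have h4 := Finset.add_sum_erase (s.erase i) (fun l => P.pairingIn ℤ γ (β l)) hj
    rw [hsum] at h4
    simp only [hj1] at h4
    have h5 : ∑ l ∈ (s.erase i).erase j, P.pairingIn ℤ γ (β l) = 0 := by lia
    refine (Finset.sum_eq_zero_iff_of_nonpos fun l hl => ?_).1 h5 l (by simp [hl, hli, hlj])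
    simp only [Finset.mem_erase] at hl
    exact hle l hl.2.2 hl.2.1
  · rw [pairingIn_eq_of_root_eq_sub hδ, h1]; simp
  · rw [pairingIn_eq_of_root_eq_sub hδ, hj1, hs.orthogonal i hi j hjs hji.symm]; simp

/-- A root of degree zero pairs to zero with any set of the `β i` that is a union of connected
components, where `i` and `j` are connected if some root of degree two pairs to one with both. -/
theorem sum_pairingIn_eq_zero (hd : ∀ γ, cascadeDegree P β s γ ≤ 2) {γ : ι}
    (hγ : cascadeDegree P β s γ = 0) {I : Finset ℕ} (hI : I ⊆ s)
    (hconn : ∀ i ∈ s, ∀ j ∈ s, ∀ δ, i ≠ j → cascadeDegree P β s δ = 2 →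
      P.pairingIn ℤ δ (β i) = 1 → P.pairingIn ℤ δ (β j) = 1 → (i ∈ I ↔ j ∈ I)) :
    ∑ i ∈ I, P.pairingIn ℤ γ (β i) = 0 := by
  by_cases h : ∃ i ∈ s, P.pairingIn ℤ γ (β i) = 1
  · obtain ⟨i, hi, h1⟩ := h
    obtain ⟨j, hj, hji, hj1, h0, δ, hδi, hδj, hδ⟩ := hs.exists_pairingIn_eq_neg_one hd hγ hi h1
    have hiff := hconn i hi j hj δ hji.symm hδ hδi hδj
    by_cases hiI : i ∈ I
    · have hjI := hiff.1 hiI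
      rw [← Finset.add_sum_erase I _ hiI,
        ← Finset.add_sum_erase (I.erase i) _ (Finset.mem_erase.2 ⟨hji, hjI⟩), h1, hj1,
        Finset.sum_eq_zero, add_zero]
      · lia
      · intro l hl
        simp only [Finset.mem_erase] at hl
        exact h0 l (hI hl.2.2) hl.2.1 hl.1
    · have hjI := fun h => hiI (hiff.2 h)
      refine Finset.sum_eq_zero fun l hl => h0 l (hI hl) ?_ ?_
      · rintro rfl; exact hiI hl
      · rintro rfl; exact hjI hl
  · push Not at h
    have hle : ∀ i ∈ s, P.pairingIn ℤ γ (β i) ≤ 0 := by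
      intro i hi
      have := h i hi
      rcases hs.pairingIn_mem_of_cascadeDegree_eq_zero hγ hi with h | h | h <;> lia
    have := (Finset.sum_eq_zero_iff_of_nonpos hle).1 hγ
    exact Finset.sum_eq_zero fun l hl => this l (hI hl)

theorem pairingIn_eq_of_pairingIn_eq_one {i j : ℕ} (hi : i ∈ s) (hj : j ∈ s) {δ : ι}
    (h1 : P.pairingIn ℤ δ (β i) = 1) (h2 : P.pairingIn ℤ δ (β j) = 1) :
    P.pairingIn ℤ (β i) δ = P.pairingIn ℤ (β j) δ := by
  have e1 := (P.posRootForm ℤ).pairingIn_mul_eq_pairingIn_mul_swap (β i) δ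
  have e2 := (P.posRootForm ℤ).pairingIn_mul_eq_pairingIn_mul_swap (β j) δ
  rw [h1, (hs.long i hi).rootLength_eq (hs.long j hj)] at e1
  rw [h2] at e2
  have := (P.posRootForm ℤ).rootLength_pos δ
  exact mul_right_cancel₀ this.ne' (e1.symm.trans e2)

/-- The constant `c` is the common squared length of the `β i`. This identity translates between
pairing `α` with the sum of the coroots and pairing the sum of the roots with the coroot of `α`,
which is the form in which dominance is given. -/
theorem exists_cascadeDegree_mul_eq :
    ∃ c : ℤ, 0 < c ∧ ∀ α, cascadeDegree P β s α * c =
      (∑ i ∈ s, P.pairingIn ℤ (β i) α) * (P.posRootForm ℤ).rootLength α := by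
  rcases s.eq_empty_or_nonempty with rfl | ⟨i, hi⟩
  · exact ⟨1, one_pos, by simp [cascadeDegree]⟩
  · refine ⟨_, (P.posRootForm ℤ).rootLength_pos (β i), fun α => ?_⟩
    rw [cascadeDegree, Finset.sum_mul, Finset.sum_mul]
    refine Finset.sum_congr rfl fun j hj => ?_
    rw [(hs.long i hi).rootLength_eq (hs.long j hj)]
    exact (P.posRootForm ℤ).pairingIn_mul_eq_pairingIn_mul_swap (β j) α

theorem sum_pairingIn_eq_zero_of_cascadeDegree_eq_zero {α : ι}
    (hα : cascadeDegree P β s α = 0) : ∑ i ∈ s, P.pairingIn ℤ (β i) α = 0 := by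
  obtain ⟨c, -, hc⟩ := hs.exists_cascadeDegree_mul_eq
  have := hc α
  rw [hα, zero_mul, eq_comm, mul_eq_zero] at this
  exact this.resolve_right ((P.posRootForm ℤ).rootLength_pos α).ne'

theorem cascadeDegree_nonneg [P.IsReduced] {b : P.Base}
    (hdom : IsDominant b (∑ i ∈ s, P.root (β i))) {α : ι} (hα : b.IsPos α) :
    0 ≤ cascadeDegree P β s α := by
  obtain ⟨c, hc0, hc⟩ := hs.exists_cascadeDegree_mul_eq
  have hsimple : ∀ i ∈ b.support, 0 ≤ cascadeDegree P β s i := by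
    intro i hi
    obtain ⟨n, hn⟩ := hdom i hi
    have : ∑ j ∈ s, P.pairingIn ℤ (β j) i = n := by
      apply FaithfulSMul.algebraMap_injective ℤ R
      simp only [map_sum, LinearMap.sum_apply, P.root_coroot_eq_pairing] at hn
      simpa [intCast_pairingIn] using hn
    have h2 := hc i
    rw [this] at h2
    have h3 : 0 ≤ (n : ℤ) * (P.posRootForm ℤ).rootLength i :=
      mul_nonneg (by positivity) ((P.posRootForm ℤ).rootLength_pos i).le
    rw [← h2] at h3
    exact nonneg_of_mul_nonneg_left h3 hc0
  refine Base.IsPos.induction_on_add hα hsimple fun i j k hk hi hj => ?_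
  rw [cascadeDegree_add hk]
  exact add_nonneg hi (hsimple j hj)

/-- The degree is additive and nonnegative on simple roots, hence largest at the highest root, where
it is 2. -/
theorem cascadeDegree_le_two {b : P.Base} {i : ℕ} (hi : i ∈ s)
    (hhigh : IsHighestRoot b (β i)) (hpos : ∀ α ∈ b.support, 0 ≤ cascadeDegree P β s α) (γ : ι) :
    cascadeDegree P β s γ ≤ 2 := by
  have key : ∀ x ∈ AddSubmonoid.closure (P.root '' (b.support : Set ι)),
      ∃ n : ℕ, ∑ i ∈ s, P.toLinearMap x (P.coroot (β i)) = n := by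
    intro x hx
    induction hx using AddSubmonoid.closure_induction with
    | mem x hx =>
      obtain ⟨i, hi, rfl⟩ := hx
      obtain ⟨n, hn⟩ := Int.eq_ofNat_of_zero_le (hpos i hi)
      refine ⟨n, ?_⟩
      have := congrArg (algebraMap ℤ R) hn
      simpa [cascadeDegree, intCast_pairingIn] using this
    | zero => exact ⟨0, by simp⟩
    | add x y _ _ hx hy =>
      obtain ⟨n, hn⟩ := hx
      obtain ⟨m, hm⟩ := hy
      exact ⟨n + m, by simp [Finset.sum_add_distrib, hn, hm]⟩
  obtain ⟨n, hn⟩ := key _ (hhigh γ)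
  have : cascadeDegree P β s (β i) - cascadeDegree P β s γ = n := by
    apply FaithfulSMul.algebraMap_injective ℤ R
    simp only [map_sub, LinearMap.sub_apply, Finset.sum_sub_distrib, P.root_coroot_eq_pairing] at hn
    simpa [cascadeDegree, intCast_pairingIn] using hn
  rw [hs.cascadeDegree_self hi] at this
  lia

end IsLongOrthogonal

theorem cascadeDegree_insert {k : ℕ} (hk : k ∉ s) (γ : ι) :
    cascadeDegree P β (insert k s) γ = P.pairingIn ℤ γ (β k) + cascadeDegree P β s γ := by
  rw [cascadeDegree, Finset.sum_insert hk, cascadeDegree]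

/-- The pairing with the long root `β k` is -1, 0 or 1. The value 1 would give `γ` degree 3, and the
value -1 would give the root `γ + β k` degree 3. -/
theorem IsLongOrthogonal.cascadeDegree_insert_eq_two {k : ℕ} (hk : k ∉ s)
    (hs : IsLongOrthogonal P β (insert k s)) (hd : ∀ γ, cascadeDegree P β (insert k s) γ ≤ 2)
    {γ : ι} (hγ : cascadeDegree P β s γ = 2) :
    P.pairingIn ℤ γ (β k) = 0 ∧ cascadeDegree P β (insert k s) γ = 2 := by
  have hks := Finset.mem_insert_self k s
  have hβk : cascadeDegree P β s (β k) = 0 := by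
    rw [cascadeDegree, hs.sum_pairingIn_self (Finset.subset_insert k s) hks, if_neg hk]
  have h1 : P.root γ ≠ P.root (β k) := by
    intro h
    rw [P.root.injective h] at hγ
    lia
  have h2 : P.root γ ≠ -P.root (β k) := by
    intro h
    rw [cascadeDegree_neg h] at hγ
    lia
  have hle := hd γ
  rw [cascadeDegree_insert hk] at hle ⊢
  rcases (hs.long k hks).pairingIn_mem h1 h2 with h | h | h
  · obtain ⟨ε, hε⟩ := P.root_add_root_mem_of_pairingIn_neg (by lia) h2
    have h3 := hd ε
    rw [cascadeDegree_add hε, hs.cascadeDegree_self hks, cascadeDegree_insert hk] at h3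
    lia
  · exact ⟨h, by lia⟩
  · lia

/-- The hypotheses force `γ` to pair nonpositively with `β k`, so the difference would pair to at
least 2 with the long root `β k`; only `β k` itself does that. -/
theorem IsLongOrthogonal.root_sub_notMem_of_cascadeDegree {k : ℕ} (hk : k ∉ s)
    (hs : IsLongOrthogonal P β (insert k s)) {γ : ι}
    (hγ : cascadeDegree P β (insert k s) γ = 0) (hγ' : 0 ≤ cascadeDegree P β s γ) :
    P.root (β k) - P.root γ ∉ Set.range P.root := by
  rintro ⟨ε, hε⟩
  rw [cascadeDegree_insert hk] at hγ
  have h3 := pairingIn_eq_of_root_eq_sub hε (β k)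
  simp only [P.pairingIn_same] at h3
  have h1 : P.root ε ≠ P.root (β k) := by
    intro h
    rw [h] at hε
    exact P.ne_zero γ (by simpa [eq_comm (a := P.root (β _)), sub_eq_self] using hε)
  have h2 : P.root ε ≠ -P.root (β k) := by
    intro h
    have := pairingIn_eq_of_root_eq_neg h (β k)
    simp at this; lia
  rcases (hs.long k (Finset.mem_insert_self k s)).pairingIn_mem h1 h2 with h | h | h <;> lia

end Degree

end SymLie

namespace SymLie

open LieAlgebra LieAlgebra.IsKilling LieModule

/-! ### Subspaces closed under a set of operators -/

section Closure

variable {K V : Type*} [Field K] [AddCommGroup V] [Module K V]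

/-- The smallest subspace that contains `U` and is stable under all operators in `T`. -/
def closureUnder (U : Submodule K V) (T : Set (Module.End K V)) : Submodule K V :=
  sInf {X | U ≤ X ∧ ∀ f ∈ T, ∀ x ∈ X, f x ∈ X}

variable {U : Submodule K V} {T : Set (Module.End K V)}

theorem le_closureUnder : U ≤ closureUnder U T :=
  le_sInf fun _ hX => hX.1

theorem closureUnder_le {X : Submodule K V} (hU : U ≤ X) (hT : ∀ f ∈ T, ∀ x ∈ X, f x ∈ X) :
    closureUnder U T ≤ X :=
  sInf_le ⟨hU, hT⟩

theorem map_mem_closureUnder {f : Module.End K V} (hf : f ∈ T) {x : V}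
    (hx : x ∈ closureUnder U T) : f x ∈ closureUnder U T := by
  simp only [closureUnder, Submodule.mem_sInf] at hx ⊢
  exact fun X hX => hX.2 f hf x (hx X hX)

/-- If commuting an operator of `G` past an operator of `T` produces operators of `G`, then the
closure of `U` under `T` is stable under `G` as soon as it contains `g u` for `g ∈ G`, `u ∈ U`. -/
theorem map_mem_closureUnder_of_commutator {G : Set (Module.End K V)}
    (hU : ∀ g ∈ G, ∀ u ∈ U, g u ∈ closureUnder U T)
    (hG : ∀ g ∈ G, ∀ f ∈ T, ∃ g' ∈ G, ∀ x, g (f x) = f (g x) + g' x)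
    {g : Module.End K V} (hg : g ∈ G) {x : V} (hx : x ∈ closureUnder U T) :
    g x ∈ closureUnder U T := by
  -- The vectors of the closure that all of `G` maps back into it; the commutation rule makes this
  -- subspace stable under `T`.
  let X : Submodule K V := closureUnder U T ⊓ ⨅ g ∈ G, (closureUnder U T).comap g
  have hmem : ∀ x, x ∈ X ↔ x ∈ closureUnder U T ∧ ∀ g ∈ G, g x ∈ closureUnder U T := by
    intro x
    simp [X, Submodule.mem_iInf]
  have h : closureUnder U T ≤ X := by
    refine closureUnder_le (fun u hu => ?_) fun f hf x hx => ?_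
    · exact (hmem u).2 ⟨le_closureUnder hu, fun g hg => hU g hg u hu⟩
    · rw [hmem] at hx ⊢
      refine ⟨map_mem_closureUnder hf hx.1, fun g hg => ?_⟩
      obtain ⟨g', hg', h⟩ := hG g hg f hf
      rw [h]
      exact add_mem (map_mem_closureUnder hf (hx.2 g hg)) (hx.2 g' hg')
  exact ((hmem x).1 (h hx)).2 g hg

/-- If every operator in `T` lowers the eigenvalues of `D` by a positive integer, then in the
closure of an eigenvector `v` under `T` the eigenspace of `v` is spanned by `v`. -/
theorem mem_span_singleton_of_mem_closureUnder [CharZero K] {D : Module.End K V} {c : K} {v : V}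
    (hv : D v = c • v)
    (hT : ∀ f ∈ T, ∃ n : ℕ, ∀ x, D (f x) = f (D x) - ((n : K) + 1) • f x)
    {x : V} (hx : x ∈ closureUnder (Submodule.span K {v}) T) (hDx : D x = c • x) :
    x ∈ Submodule.span K {v} := by
  -- The right-hand side is stable under `T`. Independence of eigenspaces then leaves only the line
  -- of `v` for the eigenvalue `c`.
  have hle : closureUnder (Submodule.span K {v}) T ≤
      Submodule.span K {v} ⊔ ⨆ n : ℕ, D.eigenspace (c - (n + 1)) := by
    refine closureUnder_le le_sup_left fun f hf x hx => ?_
    obtain ⟨n, hn⟩ := hT f hf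
    have key : ∀ (a : K) (y : V), D y = a • y → D (f y) = (a - (n + 1)) • f y := by
      intro a y hy
      rw [hn, hy, map_smul, sub_smul]
    obtain ⟨y, hy, z, hz, rfl⟩ := Submodule.mem_sup.1 hx
    rw [map_add]
    refine Submodule.mem_sup_right (add_mem ?_ ?_)
    · obtain ⟨a, rfl⟩ := Submodule.mem_span_singleton.1 hy
      rw [map_smul]
      exact Submodule.smul_mem _ _ (Submodule.mem_iSup_of_mem n
        (Module.End.mem_eigenspace_iff.2 (key c v hv)))
    · clear hx
      induction hz using Submodule.iSup_induction' with
      | mem m z hz =>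
        refine Submodule.mem_iSup_of_mem (m + n + 1) (Module.End.mem_eigenspace_iff.2 ?_)
        rw [key _ z (Module.End.mem_eigenspace_iff.1 hz)]
        congr 1
        push_cast
        ring
      | zero => simp
      | add z z' _ _ hz hz' =>
        rw [map_add]
        exact add_mem hz hz'
  obtain ⟨y, hy, z, hz, rfl⟩ := Submodule.mem_sup.1 (hle hx)
  have hyD : D y = c • y := by
    obtain ⟨a, rfl⟩ := Submodule.mem_span_singleton.1 hy
    rw [map_smul, hv, smul_comm]
  have hzD : z ∈ D.eigenspace c := by
    rw [Module.End.mem_eigenspace_iff]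
    rw [map_add, hyD, smul_add] at hDx
    exact add_left_cancel hDx
  have hz' : z ∈ ⨆ μ, ⨆ (_ : μ ≠ c), D.eigenspace μ := by
    refine (iSup_le fun n => ?_ : (⨆ n : ℕ, D.eigenspace (c - (n + 1))) ≤ _) hz
    refine le_iSup₂_of_le (c - (n + 1)) ?_ le_rfl
    intro h
    have : (n : K) + 1 = 0 := by linear_combination -h
    exact Nat.cast_add_one_ne_zero n this
  have : z = 0 := Submodule.disjoint_def.1 (D.eigenspaces_iSupIndep c) z hzD hz'
  rw [this, add_zero]
  exact hy

end Closure

/-! ### Dual root vectors and the form on weights -/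

section RootVectors

variable {L : Type*} [LieRing L] [LieAlgebra ℂ L] [FiniteDimensional ℂ L] [IsKilling ℂ L]
  {H : LieSubalgebra ℂ L} [H.IsCartanSubalgebra]

theorem eq_zero_or_mem_or_exists_root {χ : H → ℂ} {z : L} (hz : z ∈ rootSpace H χ) :
    z = 0 ∨ (χ = 0 ∧ z ∈ H) ∨ ∃ α : H.root, χ = α.1 := by
  by_cases hz0 : z = 0
  · exact Or.inl hz0
  right
  by_cases hχ : χ = 0
  · subst hχ
    left
    simpa using hz
  right
  let α : Weight ℂ H L := ⟨χ, fun h => hz0 (by simpa [h] using hz)⟩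
  refine ⟨⟨α, ?_⟩, rfl⟩
  exact Finset.mem_filter.2 ⟨Finset.mem_univ _, hχ⟩

theorem lie_mem_rootSpace_add {χ ψ : H → ℂ} {x y : L} (hx : x ∈ rootSpace H χ)
    (hy : y ∈ rootSpace H ψ) : ⁅x, y⁆ ∈ rootSpace H (χ + ψ) :=
  LieAlgebra.lie_mem_genWeightSpace_of_mem_genWeightSpace hx hy

theorem mem_rootSpace_of_mem {t : L} (ht : t ∈ H) : t ∈ rootSpace H (0 : H → ℂ) := by
  simpa using ht

theorem exists_killingForm_eq_one {χ : H → ℂ} {x : L} (hx : x ∈ rootSpace H χ) (h0 : x ≠ 0) :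
    ∃ y ∈ rootSpace H (-χ), killingForm ℂ L x y = 1 := by
  obtain ⟨y, hy, h⟩ : ∃ y ∈ rootSpace H (-χ), killingForm ℂ L x y ≠ 0 := by
    contrapose! h0
    simpa using mem_ker_killingForm_of_mem_rootSpace_of_forall_rootSpace_neg ℂ L H hx h0
  exact ⟨(killingForm ℂ L x y)⁻¹ • y, Submodule.smul_mem _ _ hy, by simp [h]⟩

variable (H) in
/-- Root vectors `u α` and `v α` for each pair `α`, `-α` of opposite roots that are dual for the
Killing form. -/
structure DualRootVectors where
  u : H.root → L
  v : H.root → L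
  u_mem : ∀ α, u α ∈ rootSpace H α.1
  v_mem : ∀ α, v α ∈ rootSpace H (-(α.1 : H → ℂ))
  killingForm_eq_one : ∀ α, killingForm ℂ L (u α) (v α) = 1

instance : Nonempty (DualRootVectors H) := by
  have h : ∀ α : H.root, ∃ u v : L, u ∈ rootSpace H α.1 ∧ v ∈ rootSpace H (-(α.1 : H → ℂ)) ∧
      killingForm ℂ L u v = 1 := by
    intro α
    obtain ⟨u, hu, hu0⟩ := α.1.exists_ne_zero
    obtain ⟨v, hv, h⟩ := exists_killingForm_eq_one hu hu0
    exact ⟨u, v, hu, hv, h⟩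
  choose u v h1 h2 h3 using h
  exact ⟨⟨u, v, h1, h2, h3⟩⟩

/-- The element of the Cartan subalgebra dual to a weight. -/
noncomputable def dualElt (χ : Module.Dual ℂ H) : H := (cartanEquivDual H).symm χ

theorem dualElt_add (χ ψ : Module.Dual ℂ H) : dualElt (χ + ψ) = dualElt χ + dualElt ψ :=
  map_add _ _ _

theorem dualElt_sub (χ ψ : Module.Dual ℂ H) : dualElt (χ - ψ) = dualElt χ - dualElt ψ :=
  map_sub _ _ _

theorem killingForm_dualElt (χ : Module.Dual ℂ H) (t : H) :
    killingForm ℂ L (dualElt χ : L) t = χ t :=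
  LinearMap.BilinForm.apply_toDual_symm_apply (hB := traceForm_cartan_nondegenerate ℂ L H) _ _

theorem apply_dualElt_comm (χ ψ : Module.Dual ℂ H) : χ (dualElt ψ) = ψ (dualElt χ) := by
  rw [← killingForm_dualElt χ, ← killingForm_dualElt ψ]
  exact traceForm_comm ℂ L L _ _

theorem root_apply_dualElt_ne_zero (α : H.root) : α.1 (dualElt α.1.toLinear) ≠ 0 :=
  root_apply_cartanEquivDual_symm_ne_zero (LieSubalgebra.isNonZero_coe_root α)

theorem two_smul_dualElt (α : H.root) :
    (2 : ℂ) • dualElt α.1.toLinear = α.1 (dualElt α.1.toLinear) • coroot α.1 := by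
  have h := root_apply_dualElt_ne_zero α
  rw [coroot, ← Nat.cast_smul_eq_nsmul ℂ, smul_smul, smul_smul]
  change _ = (α.1 (dualElt α.1.toLinear) * ((2 : ℕ) : ℂ) * (α.1 (dualElt α.1.toLinear))⁻¹) •
    dualElt α.1.toLinear
  congr 1
  field_simp
  simp

theorem two_mul_apply_dualElt (χ : Module.Dual ℂ H) (α : H.root) :
    2 * χ (dualElt α.1.toLinear) = α.1 (dualElt α.1.toLinear) * χ (coroot α.1) := by
  rw [← smul_eq_mul, ← map_smul, two_smul_dualElt, map_smul, smul_eq_mul]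

theorem lie_eq_dualElt {α : H.root} {e f : L} (he : e ∈ rootSpace H α.1)
    (hf : f ∈ rootSpace H (-(α.1 : H → ℂ))) (h : killingForm ℂ L e f = 1) :
    ⁅e, f⁆ = (dualElt α.1.toLinear : L) := by
  rw [lie_eq_killingForm_smul_of_mem_rootSpace_of_mem_rootSpace_neg he hf, h, one_smul]
  rfl

/-- The squared length of a root with respect to the Killing form is positive. -/
theorem exists_pos_root_apply_dualElt (α : H.root) :
    ∃ q : ℝ, 0 < q ∧ α.1 (dualElt α.1.toLinear) = q := by
  have h0 := root_apply_dualElt_ne_zero α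
  set A := α.1 (dualElt α.1.toLinear) with hA
  -- The Killing form on the Cartan subalgebra is the sum of the squares of the roots, and `2 γ(t_α)
  -- = A ⟨γ, α^∨⟩` for the dual element `t_α`. This gives `4 A = A² Q`, hence `A = 4 / Q`.
  set Q : ℤ := ∑ γ : H.root, (rootSystem H).pairingIn ℤ γ α ^ 2 with hQ
  have h1 : A = ∑ γ : H.root, γ.1 (dualElt α.1.toLinear) ^ 2 := by
    have h2 := congrArg (fun B => B (dualElt α.1.toLinear) (dualElt α.1.toLinear))
      (restrict_killingForm_eq_sum (K := ℂ) (L := L) (H := H))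
    rw [← Finset.sum_coe_sort] at h2
    simp only [LinearMap.sum_apply] at h2
    have h3 := killingForm_dualElt α.1.toLinear (dualElt α.1.toLinear)
    change _ = A at h3
    rw [← h3]
    refine h2.trans (Finset.sum_congr rfl fun γ _ => ?_)
    rw [pow_two]
    rfl
  have h4 : 4 * A = A ^ 2 * Q := by
    conv_lhs => rw [h1]
    rw [hQ, Int.cast_sum, Finset.mul_sum, Finset.mul_sum]
    refine Finset.sum_congr rfl fun γ _ => ?_
    have h5 := two_mul_apply_dualElt γ.1.toLinear α
    rw [← hA] at h5
    have h6 : ((rootSystem H).pairingIn ℤ γ α : ℂ) = γ.1 (coroot α.1) := by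
      rw [intCast_pairingIn, rootSystem_pairing_apply]
    push_cast
    rw [h6]
    simp only [Weight.toLinear_apply] at h5
    linear_combination (2 * γ.1 (dualElt α.1.toLinear) + A * γ.1 (coroot α.1)) * h5
  have h7 : A * Q = 4 := by
    apply mul_left_cancel₀ h0
    linear_combination -h4
  have hQ0 : 0 < Q := by
    refine lt_of_le_of_ne (Finset.sum_nonneg fun _ _ => sq_nonneg _) fun h => ?_
    rw [← h] at h7
    simp at h7
  refine ⟨4 / Q, by positivity, ?_⟩
  have : (Q : ℂ) ≠ 0 := by exact_mod_cast hQ0.ne'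
  push_cast
  rw [eq_div_iff this, h7]

namespace DualRootVectors

variable (X : DualRootVectors H)

theorem u_ne_zero (α : H.root) : X.u α ≠ 0 := by
  intro h
  simpa [h] using X.killingForm_eq_one α

theorem v_ne_zero (α : H.root) : X.v α ≠ 0 := by
  intro h
  simpa [h] using X.killingForm_eq_one α

theorem killingForm_v_u (α : H.root) : killingForm ℂ L (X.v α) (X.u α) = 1 := by
  rw [← X.killingForm_eq_one α]
  exact traceForm_comm ℂ L L _ _

theorem lie_u_v (α : H.root) : ⁅X.u α, X.v α⁆ = (dualElt α.1.toLinear : L) :=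
  lie_eq_dualElt (X.u_mem α) (X.v_mem α) (X.killingForm_eq_one α)

theorem eq_smul_u {α : H.root} {x : L} (hx : x ∈ rootSpace H α.1) :
    x = killingForm ℂ L (X.v α) x • X.u α := by
  have h1 := finrank_rootSpace_eq_one α.1 (LieSubalgebra.isNonZero_coe_root α)
  obtain ⟨c, hc⟩ := (finrank_eq_one_iff_of_nonzero' (⟨X.u α, X.u_mem α⟩ : rootSpace H α.1)
    (by simpa [LieSubmodule.mk_eq_zero] using X.u_ne_zero α)).1 h1 ⟨x, hx⟩
  replace hc : c • X.u α = x := congrArg Subtype.val hc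
  rw [← hc, map_smul, X.killingForm_v_u, smul_eq_mul, mul_one]

theorem eq_smul_v {α : H.root} {x : L} (hx : x ∈ rootSpace H (-(α.1 : H → ℂ))) :
    x = killingForm ℂ L (X.u α) x • X.v α := by
  have h1 := finrank_rootSpace_eq_one (-α.1) (LieSubalgebra.isNonZero_coe_root α).neg
  rw [Weight.coe_neg] at h1
  obtain ⟨c, hc⟩ := (finrank_eq_one_iff_of_nonzero'
    (⟨X.v α, X.v_mem α⟩ : rootSpace H (-(α.1 : H → ℂ)))
    (by simpa [LieSubmodule.mk_eq_zero] using X.v_ne_zero α)).1 h1 ⟨x, hx⟩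
  replace hc : c • X.v α = x := congrArg Subtype.val hc
  rw [← hc, map_smul, X.killingForm_eq_one, smul_eq_mul, mul_one]

theorem killingForm_eq_zero_of_ne {α : H.root} {χ : H → ℂ} {x : L} (hx : x ∈ rootSpace H χ)
    (h : χ ≠ α.1) : killingForm ℂ L (X.v α) x = 0 :=
  killingForm_apply_eq_zero_of_mem_rootSpace_of_add_ne_zero ℂ L H (X.v_mem α) hx
    fun h' => h (by rwa [neg_add_eq_zero, eq_comm] at h')

end DualRootVectors

end RootVectors

end SymLie

namespace SymLie

open LieAlgebra LieAlgebra.IsKilling LieModule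

variable {L : Type*} [LieRing L] [LieAlgebra ℂ L] [FiniteDimensional ℂ L] [IsKilling ℂ L]
  {H : LieSubalgebra ℂ L} [H.IsCartanSubalgebra]

theorem rootSpace_induction {p : L → Prop}
    (mem : ∀ (χ : H → ℂ), ∀ x ∈ rootSpace H χ, p x) (zero : p 0)
    (add : ∀ x y, p x → p y → p (x + y)) (x : L) : p x := by
  have hx : x ∈ ⨆ χ, rootSpace H χ := by simp [iSup_genWeightSpace_eq_top ℂ H L]
  induction hx using LieSubmodule.iSup_induction' with
  | mem χ y hy => exact mem χ y hy
  | zero => exact zero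
  | add y z _ _ hy hz => exact add y z hy hz

/-! ### The Casimir operator -/

section Casimir

namespace DualRootVectors

variable (X : DualRootVectors H)

/-- A basis of `L` that consists of root vectors and of a basis of the Cartan subalgebra. -/
noncomputable def fam : H.root ⊕ Fin (Module.finrank ℂ H) → L :=
  Sum.elim X.u fun i => (Module.finBasis ℂ H i : L)

/-- The basis of `L` dual to `X.fam` for the Killing form. -/
noncomputable def famDual : H.root ⊕ Fin (Module.finrank ℂ H) → L :=
  Sum.elim X.v fun i => (dualElt ((Module.finBasis ℂ H).coord i) : L)

theorem sum_killingForm_famDual_smul_fam (x : L) :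
    ∑ j, killingForm ℂ L (X.famDual j) x • X.fam j = x := by
  induction x using rootSpace_induction (H := H) with
  | zero => simp
  | add x y hx hy => simp only [map_add, add_smul, Finset.sum_add_distrib, hx, hy]
  | mem χ x hx =>
    rw [Fintype.sum_sum_type]
    simp only [fam, famDual, Sum.elim_inl, Sum.elim_inr]
    rcases eq_zero_or_mem_or_exists_root hx with rfl | ⟨rfl, hH⟩ | ⟨α, rfl⟩
    · simp
    · rw [Finset.sum_eq_zero, zero_add]
      · have h := congrArg (Subtype.val : H → L) ((Module.finBasis ℂ H).sum_repr ⟨x, hH⟩)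
        simp only [AddSubmonoidClass.coe_finsetSum] at h
        refine (Finset.sum_congr rfl fun i _ => ?_).trans h
        exact congrArg (· • (Module.finBasis ℂ H i : L))
          (killingForm_dualElt ((Module.finBasis ℂ H).coord i) ⟨x, hH⟩)
      · intro α _
        rw [X.killingForm_eq_zero_of_ne hx, zero_smul]
        intro h
        exact LieSubalgebra.isNonZero_coe_root α h.symm
    · rw [Finset.sum_eq_single_of_mem α (Finset.mem_univ _), Finset.sum_eq_zero, add_zero]
      · exact (X.eq_smul_u hx).symm
      · intro i _
        rw [killingForm_apply_eq_zero_of_mem_rootSpace_of_add_ne_zero ℂ L H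
          (mem_rootSpace_of_mem (Subtype.property _)) hx, zero_smul]
        rw [zero_add]
        exact LieSubalgebra.isNonZero_coe_root α
      · intro γ _ hγ
        rw [X.killingForm_eq_zero_of_ne hx, zero_smul]
        intro h
        exact hγ (Subtype.ext (Weight.ext (congrFun h.symm)))

/-- The Killing form is symmetric and nondegenerate, so the expansion in `fam` dualizes. -/
theorem sum_killingForm_fam_smul_famDual (x : L) :
    ∑ j, killingForm ℂ L (X.fam j) x • X.famDual j = x := by
  rw [← sub_eq_zero, ← Submodule.mem_bot ℂ, ← ker_killingForm_eq_bot (R := ℂ) (L := L),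
    LinearMap.mem_ker]
  ext y
  have h : killingForm ℂ L x y = ∑ j, killingForm ℂ L (X.fam j) x *
      killingForm ℂ L (X.famDual j) y := by
    conv_lhs => rw [← X.sum_killingForm_famDual_smul_fam y]
    rw [map_sum]
    refine Finset.sum_congr rfl fun j _ => ?_
    rw [map_smul, smul_eq_mul, mul_comm, traceForm_comm ℂ L L x]
  rw [map_sub, LinearMap.sub_apply, h]
  simp

end DualRootVectors

/-- Invariance of the canonical element `∑ j, e j ⊗ e' j` of two dual families, for an operator
that preserves their spans. -/
theorem sum_apply_add_sum_apply_eq_zero {J W : Type*} [Fintype J] [AddCommGroup W] [Module ℂ W]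
    {e e' : J → L} (B : L →ₗ[ℂ] L →ₗ[ℂ] W) (z : L)
    (he : ∀ j, ∑ i, killingForm ℂ L (e' i) ⁅z, e j⁆ • e i = ⁅z, e j⁆)
    (he' : ∀ j, ∑ i, killingForm ℂ L (e i) ⁅z, e' j⁆ • e' i = ⁅z, e' j⁆) :
    ∑ j, B ⁅z, e j⁆ (e' j) + ∑ j, B (e j) ⁅z, e' j⁆ = 0 := by
  have h1 : ∑ j, B ⁅z, e j⁆ (e' j) =
      ∑ j, ∑ i, killingForm ℂ L (e' i) ⁅z, e j⁆ • B (e i) (e' j) := by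
    refine Finset.sum_congr rfl fun j _ => ?_
    conv_lhs => rw [← he j]
    simp
  have h2 : ∑ j, B (e j) ⁅z, e' j⁆ =
      ∑ j, ∑ i, killingForm ℂ L (e i) ⁅z, e' j⁆ • B (e j) (e' i) := by
    refine Finset.sum_congr rfl fun j _ => ?_
    conv_lhs => rw [← he' j]
    simp
  -- By invariance of the Killing form, the matrix of `z` on `e'` is minus the transpose of its
  -- matrix on `e`, so the double sums cancel term by term.
  rw [h1, h2, Finset.sum_comm, ← Finset.sum_add_distrib]
  refine Finset.sum_eq_zero fun i _ => ?_
  rw [← Finset.sum_add_distrib]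
  refine Finset.sum_eq_zero fun j _ => ?_
  rw [← add_smul]
  have h3 : killingForm ℂ L ⁅z, e' i⁆ (e j) = -killingForm ℂ L (e' i) ⁅z, e j⁆ :=
    LieModule.traceForm_apply_lie_apply' ℂ L L z (e' i) (e j)
  have h4 : killingForm ℂ L (e j) ⁅z, e' i⁆ = killingForm ℂ L ⁅z, e' i⁆ (e j) :=
    traceForm_comm ℂ L L _ _
  rw [h4, h3, add_neg_cancel, zero_smul]

variable {V : Type*} [AddCommGroup V] [Module ℂ V] [LieRingModule L V] [LieModule ℂ L V]

/-- The Casimir operator of a representation. -/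
noncomputable def casimir (X : DualRootVectors H) (V : Type*) [AddCommGroup V] [Module ℂ V]
    [LieRingModule L V] [LieModule ℂ L V] : Module.End ℂ V :=
  ∑ j, toEnd ℂ L V (X.fam j) ∘ₗ toEnd ℂ L V (X.famDual j)

theorem casimir_apply (X : DualRootVectors H) (a : V) :
    casimir X V a = ∑ j, ⁅X.fam j, ⁅X.famDual j, a⁆⁆ := by
  simp [casimir]

/-- Moving `z` past both factors of each summand leaves the invariance identity of the canonical
element, for the bilinear map `(x, y) ↦ ⁅x, ⁅y, a⁆⁆`. -/
theorem casimir_lie (X : DualRootVectors H) (z : L) (a : V) :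
    casimir X V ⁅z, a⁆ = ⁅z, casimir X V a⁆ := by
  let B : L →ₗ[ℂ] L →ₗ[ℂ] V := LinearMap.mk₂ ℂ (fun x y => ⁅x, ⁅y, a⁆⁆)
    (by simp) (by simp) (by simp) (by simp)
  have h := sum_apply_add_sum_apply_eq_zero B z (e := X.fam) (e' := X.famDual)
    (fun j => X.sum_killingForm_famDual_smul_fam _)
    (fun j => X.sum_killingForm_fam_smul_famDual _)
  rw [casimir_apply, casimir_apply, lie_sum, ← sub_eq_zero, ← neg_eq_zero, ← h,
    ← Finset.sum_add_distrib, ← Finset.sum_sub_distrib, ← Finset.sum_neg_distrib]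
  refine Finset.sum_congr rfl fun j _ => ?_
  simp only [B, LinearMap.mk₂_apply]
  rw [leibniz_lie z (X.fam j), leibniz_lie z (X.famDual j), lie_add]
  abel

/-- The eigenvalue of the Casimir operator on a highest weight vector of weight `μ`. -/
noncomputable def casimirValue (b : (rootSystem H).Base) (μ : Module.Dual ℂ H) : ℂ := by
  classical
  exact μ (dualElt μ) + ∑ α : H.root, if b.IsPos α then μ (dualElt α.1.toLinear) else 0

theorem isPos_of_coe_eq_neg {b : (rootSystem H).Base} {α : H.root} (hα : ¬ b.IsPos α)
    {γ : H.root} (h : (γ.1 : H → ℂ) = -(α.1 : H → ℂ)) : b.IsPos γ := by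
  let := (rootSystem H).indexNeg
  have : γ = -α := by
    apply (rootSystem H).root.injective
    rw [(rootSystem H).indexNeg_neg, (rootSystem H).root_reflectionPerm,
      (rootSystem H).reflection_apply_self]
    ext x
    exact congrFun h x
  rw [this]
  exact (RootPairing.Base.IsPos.neg_iff_not b α).2 hα

theorem exists_coe_eq_neg (α : H.root) : ∃ γ : H.root, (γ.1 : H → ℂ) = -(α.1 : H → ℂ) :=
  ⟨⟨-α.1, Finset.mem_filter.2 ⟨Finset.mem_univ _,
    (LieSubalgebra.isNonZero_coe_root α).neg⟩⟩, Weight.coe_neg⟩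

/-- The Cartan part contributes `(μ, μ)`. For positive `α`, `u α` kills `a`, so only the commutator
`⁅u α, v α⁆` survives and contributes `(μ, α)`. For negative `α`, `v α` is a positive root vector
and kills `a`. -/
theorem IsHighestWeightVector.casimir_apply {b : (rootSystem H).Base} {μ : Module.Dual ℂ H} {a : V}
    (ha : IsHighestWeightVector b μ a) (X : DualRootVectors H) :
    casimir X V a = casimirValue b μ • a := by
  classical
  rw [SymLie.casimir_apply, Fintype.sum_sum_type, casimirValue, add_smul, add_comm, Finset.sum_smul]
  simp only [DualRootVectors.fam, DualRootVectors.famDual, Sum.elim_inl, Sum.elim_inr]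
  congr 1
  · simp only [ha.lie_cartan, lie_smul, smul_smul]
    rw [← Finset.sum_smul]
    congr 1
    have h : μ = ∑ i, μ (Module.finBasis ℂ H i) • (Module.finBasis ℂ H).coord i := by
      apply (Module.finBasis ℂ H).ext
      intro j
      simp
    have h2 : dualElt μ =
        ∑ i, μ (Module.finBasis ℂ H i) • dualElt ((Module.finBasis ℂ H).coord i) := by
      conv_lhs => rw [h]
      simp only [dualElt, map_sum, map_smul]
    rw [h2, map_sum]
    refine Finset.sum_congr rfl fun i _ => ?_
    rw [map_smul, smul_eq_mul, mul_comm]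
  · refine Finset.sum_congr rfl fun α _ => ?_
    split_ifs with hα
    · rw [leibniz_lie, X.lie_u_v, ha.lie_pos α hα _ (X.u_mem α), lie_zero, add_zero,
        ha.lie_cartan]
    · obtain ⟨γ, hγ⟩ := exists_coe_eq_neg α
      rw [ha.lie_pos γ (isPos_of_coe_eq_neg hα hγ) (X.v α) (by rw [hγ]; exact X.v_mem α), lie_zero,
        zero_smul]

end Casimir

/-! ### Casimir eigenvalues of comparable dominant weights -/

section Inequality

variable {b : (rootSystem H).Base}

/-- The simple reflection at `i` permutes the positive roots other than `i` and negates their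
pairings with `i`, so these cancel and only the pairing of `i` with itself remains. -/
theorem two_rho_apply_coroot [DecidablePred b.IsPos] {i : H.root} (hi : i ∈ b.support) :
    ∑ α : H.root, (if b.IsPos α then (rootSystem H).pairing α i else 0) = 2 := by
  classical
  rw [← Finset.sum_filter]
  have hmem : i ∈ Finset.univ.filter b.IsPos := by
    simpa using RootPairing.Base.isPos_of_mem_support hi
  rw [← Finset.add_sum_erase _ _ hmem, RootPairing.pairing_same, add_eq_left]
  refine Finset.sum_involution (fun α _ => (rootSystem H).reflectionPerm i α) ?_ ?_ ?_ ?_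
  · intro α _
    rw [← RootPairing.root_coroot_eq_pairing, ← RootPairing.root_coroot_eq_pairing,
      RootPairing.root_reflectionPerm, RootPairing.reflection_apply_root, map_sub,
      LinearMap.sub_apply, map_smul, LinearMap.smul_apply, RootPairing.root_coroot_eq_pairing,
      RootPairing.root_coroot_eq_pairing, RootPairing.pairing_same, smul_eq_mul]
    ring
  · intro α _ h0 h
    apply h0
    have h1 := congrArg (rootSystem H).root h
    rw [RootPairing.root_reflectionPerm, RootPairing.reflection_apply_root, sub_eq_self,
      smul_eq_zero] at h1
    exact h1.resolve_right ((rootSystem H).ne_zero i)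
  · intro α hα
    simp only [Finset.mem_erase, Finset.mem_filter, Finset.mem_univ, true_and] at hα ⊢
    refine ⟨fun h => ?_, hα.2.reflectionPerm hi hα.1⟩
    have h1 := (RootPairing.Base.IsPos.reflectionPerm hα.2 hi hα.1)
    rw [h] at h1
    have h2 : α = (rootSystem H).reflectionPerm i i := by
      have := congrArg ((rootSystem H).reflectionPerm i) h
      rwa [RootPairing.reflectionPerm_self] at this
    let := (rootSystem H).indexNeg
    have h3 : b.IsPos (-i) := by
      rw [(rootSystem H).indexNeg_neg, ← h2]; exact hα.2
    exact (RootPairing.Base.IsPos.neg_iff_not b i).1 h3 (RootPairing.Base.isPos_of_mem_support hi)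
  · intro α _
    exact RootPairing.reflectionPerm_self _ _ _

/-- The two eigenvalues differ by `(λ + μ + 2ρ, λ - μ)`. The first argument `ψ` is strictly
dominant, so the product with a nonzero sum of simple roots is positive. -/
theorem eq_of_casimirValue_eq {lam μ : Module.Dual ℂ H} (hlam : IsDominant b lam)
    (hμ : IsDominant b μ)
    (hsub : lam - μ ∈ AddSubmonoid.closure ((rootSystem H).root '' (b.support : Set H.root)))
    (h : casimirValue b lam = casimirValue b μ) : lam = μ := by
  classical
  let ψ : Module.Dual ℂ H := lam + μ +
    ∑ α : H.root, if b.IsPos α then α.1.toLinear else 0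
  have key : ∀ x ∈ AddSubmonoid.closure ((rootSystem H).root '' (b.support : Set H.root)),
      ∃ r : ℝ, ψ (dualElt x) = r ∧ 0 ≤ r ∧ (x ≠ 0 → 0 < r) := by
    intro x hx
    induction hx using AddSubmonoid.closure_induction with
    | mem x hx =>
      obtain ⟨i, hi, rfl⟩ := hx
      obtain ⟨q, hq, hqi⟩ := exists_pos_root_apply_dualElt i
      obtain ⟨n, hn⟩ := hlam i hi
      obtain ⟨m, hm⟩ := hμ i hi
      have h1 := two_mul_apply_dualElt ψ i
      have h2 : ψ (coroot i.1) = n + m + 2 := by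
        rw [← two_rho_apply_coroot hi]
        simp only [ψ, LinearMap.add_apply, LinearMap.sum_apply]
        refine congrArg₂ _ (congrArg₂ _ hn hm) (Finset.sum_congr rfl fun α _ => ?_)
        split_ifs <;> rfl
      rw [h2, hqi] at h1
      have h3 : 0 < q * (n + m + 2) / 2 := by positivity
      refine ⟨q * (n + m + 2) / 2, ?_, h3.le, fun _ => h3⟩
      push_cast
      rw [← h1]
      change ψ (dualElt i.1.toLinear) = _
      ring
    | zero => exact ⟨0, by simp [dualElt], le_rfl, by simp⟩
    | add x y _ _ hx hy =>
      obtain ⟨r, hr, hr0, hr1⟩ := hx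
      obtain ⟨s, hs, hs0, hs1⟩ := hy
      refine ⟨r + s, by rw [dualElt_add, map_add, hr, hs]; simp, add_nonneg hr0 hs0, fun hne => ?_⟩
      by_cases hx0 : x = 0
      · have : y ≠ 0 := by rintro rfl; exact hne (by simp [hx0])
        linarith [hs1 this]
      · linarith [hr1 hx0]
  obtain ⟨r, hr, -, hr1⟩ := key _ hsub
  by_contra hne
  have hpos := hr1 (sub_ne_zero.2 hne)
  have h0 : ψ (dualElt (lam - μ)) = 0 := by
    have h1 : casimirValue b lam - casimirValue b μ = ψ (dualElt (lam - μ)) := by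
      have h2 : ∑ α : H.root, (if b.IsPos α then lam (dualElt α.1.toLinear) else 0) -
          ∑ α : H.root, (if b.IsPos α then μ (dualElt α.1.toLinear) else 0) =
          (∑ α : H.root, if b.IsPos α then α.1.toLinear else 0) (dualElt (lam - μ)) := by
        rw [← Finset.sum_sub_distrib, LinearMap.sum_apply]
        refine Finset.sum_congr rfl fun α _ => ?_
        split_ifs
        · rw [apply_dualElt_comm α.1.toLinear, LinearMap.sub_apply]
        · simp
      simp only [casimirValue, ψ, LinearMap.add_apply]
      rw [← h2, dualElt_sub, map_sub, map_sub, apply_dualElt_comm lam μ]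
      ring
    rw [← h1, h, sub_self]
  rw [h0] at hr
  exact hpos.ne (by exact_mod_cast hr)

end Inequality

end SymLie

/-! ### Highest weight vectors and the submodules they generate -/

namespace SymLie

open LieAlgebra LieAlgebra.IsKilling LieModule

variable {L : Type*} [LieRing L] [LieAlgebra ℂ L] [FiniteDimensional ℂ L] [IsKilling ℂ L]
  {H : LieSubalgebra ℂ L} [H.IsCartanSubalgebra]
  {V : Type*} [AddCommGroup V] [Module ℂ V] [LieRingModule L V] [LieModule ℂ L V]

/-- There is an element of the Cartan subalgebra on which every root takes its height as value. -/
theorem exists_forall_root_apply_eq_height (b : (rootSystem H).Base) :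
    ∃ d : H, ∀ α : H.root, α.1 d = b.height α := by
  let f : Module.Dual ℂ (Module.Dual ℂ H) := b.toWeightBasis.constr ℂ fun _ => (1 : ℂ)
  let d : H := (Module.evalEquiv ℂ H).symm f
  have hd : ∀ χ : Module.Dual ℂ H, χ d = f χ := fun χ =>
    Module.apply_evalEquiv_symm_apply ℂ H χ f
  refine ⟨d, fun α => ?_⟩
  obtain ⟨g, -, -, hg⟩ := b.exists_root_eq_sum_int α
  rw [RootPairing.Base.height_eq_sum hg]
  change (rootSystem H).root α d = _
  rw [hd, hg, map_sum, Int.cast_sum]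
  refine Finset.sum_congr rfl fun i hi => ?_
  rw [map_zsmul]
  have : f ((rootSystem H).root i) = 1 := by
    have := b.toWeightBasis.constr_basis ℂ (fun _ => (1 : ℂ)) ⟨i, hi⟩
    rwa [RootPairing.Base.toWeightBasis_apply] at this
  rw [this]
  simp

theorem root_mem_closure_of_isPos {b : (rootSystem H).Base} {α : H.root} (hα : b.IsPos α) :
    (rootSystem H).root α ∈
      AddSubmonoid.closure ((rootSystem H).root '' (b.support : Set H.root)) := by
  refine RootPairing.Base.IsPos.induction_on_add hα (p := fun α => (rootSystem H).root α ∈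
    AddSubmonoid.closure ((rootSystem H).root '' (b.support : Set H.root))) ?_ fun i j k hk hi hj => ?_
  · exact fun i hi => AddSubmonoid.subset_closure ⟨i, hi, rfl⟩
  · rw [hk]
    exact add_mem hi (AddSubmonoid.subset_closure ⟨j, hj, rfl⟩)

theorem height_neg_of_not_isPos {b : (rootSystem H).Base} {α : H.root} (hα : ¬ b.IsPos α) :
    ∃ n : ℕ, (b.height α : ℂ) = -((n : ℂ) + 1) := by
  have h := b.height_ne_zero α
  rw [RootPairing.Base.isPos_iff] at hα
  refine ⟨(-b.height α - 1).toNat, ?_⟩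
  have : ((-b.height α - 1).toNat : ℤ) = -b.height α - 1 := Int.toNat_of_nonneg (by lia)
  have h2 := congrArg (Int.cast : ℤ → ℂ) this
  push_cast at h2
  rw [h2]
  ring

/-- The operators by which the negative root vectors act on a representation. -/
def loweringOperators (b : (rootSystem H).Base) (V : Type*) [AddCommGroup V] [Module ℂ V]
    [LieRingModule L V] [LieModule ℂ L V] : Set (Module.End ℂ V) :=
  {f | ∃ α : H.root, ¬ b.IsPos α ∧ ∃ z ∈ rootSpace H α.1, f = toEnd ℂ L V z}

/-- The smallest subspace that contains `v` and is stable under all negative root vectors. -/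
noncomputable def cyclicSpan (b : (rootSystem H).Base) (v : V) : Submodule ℂ V :=
  closureUnder (Submodule.span ℂ {v}) (loweringOperators b V)

theorem mem_cyclicSpan_self (b : (rootSystem H).Base) (v : V) : v ∈ cyclicSpan b v :=
  le_closureUnder (Submodule.mem_span_singleton_self v)

theorem lie_mem_cyclicSpan {b : (rootSystem H).Base} {v x : V} {α : H.root} (hα : ¬ b.IsPos α)
    {z : L} (hz : z ∈ rootSpace H α.1) (hx : x ∈ cyclicSpan b v) : ⁅z, x⁆ ∈ cyclicSpan b v :=
  map_mem_closureUnder (T := loweringOperators b V) (f := toEnd ℂ L V z) ⟨α, hα, z, hz, rfl⟩ hx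

theorem cyclicSpan_le {b : (rootSystem H).Base} {v : V} {U : LieSubmodule ℂ L V} (hv : v ∈ U) :
    cyclicSpan b v ≤ U.toSubmodule := by
  refine closureUnder_le (by simpa using hv) ?_
  rintro _ ⟨α, -, z, -, rfl⟩ x hx
  exact U.lie_mem hx

namespace IsHighestWeightVector

variable {b : (rootSystem H).Base} {lam μ : Module.Dual ℂ H} {v a : V}

theorem lie_mem_cyclicSpan (hv : IsHighestWeightVector b lam v) (z : L) {x : V}
    (hx : x ∈ cyclicSpan b v) : ⁅z, x⁆ ∈ cyclicSpan b v := by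
  induction z using rootSpace_induction (H := H) with
  | zero => simp
  | add y z hy hz =>
    rw [add_lie]
    exact add_mem hy hz
  | mem χ z hz =>
    -- All homogeneous elements form a family closed under brackets with lowering operators, so
    -- stability needs checking only on `v`.
    refine map_mem_closureUnder_of_commutator
      (G := {f | ∃ χ : H → ℂ, ∃ z ∈ rootSpace H χ, f = toEnd ℂ L V z}) ?_ ?_
      (g := toEnd ℂ L V z) ⟨χ, z, hz, rfl⟩ hx
    · rintro _ ⟨χ, z, hz, rfl⟩ u hu
      obtain ⟨c, rfl⟩ := Submodule.mem_span_singleton.1 hu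
      rw [map_smul]
      refine Submodule.smul_mem _ _ ?_
      change ⁅z, v⁆ ∈ cyclicSpan b v
      rcases eq_zero_or_mem_or_exists_root hz with rfl | ⟨rfl, hH⟩ | ⟨α, rfl⟩
      · simp
      · have := hv.lie_cartan ⟨z, hH⟩
        rw [this]
        exact Submodule.smul_mem _ _ (mem_cyclicSpan_self b v)
      · by_cases hα : b.IsPos α
        · rw [hv.lie_pos α hα z hz]
          exact zero_mem _
        · exact SymLie.lie_mem_cyclicSpan hα hz (mem_cyclicSpan_self b v)
    · rintro _ ⟨χ, z, hz, rfl⟩ _ ⟨α, -, y, hy, rfl⟩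
      exact ⟨_, ⟨_, _, lie_mem_rootSpace_add hz hy, rfl⟩, fun x => by simp⟩

theorem cyclicSpan_le_iSup_weightSpace (hv : IsHighestWeightVector b lam v) :
    cyclicSpan b v ≤ ⨆ ν ∈ AddSubmonoid.closure ((rootSystem H).root '' (b.support : Set H.root)),
      (weightSpace V (lam - ν : H → ℂ)).toSubmodule := by
  refine closureUnder_le ?_ ?_
  · rw [Submodule.span_singleton_le_iff_mem]
    refine Submodule.mem_iSup_of_mem 0 (Submodule.mem_iSup_of_mem (zero_mem _) ?_)
    rw [LieSubmodule.mem_toSubmodule, mem_weightSpace]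
    intro t
    simpa using! hv.lie_cartan t
  · rintro _ ⟨α, hα, z, hz, rfl⟩ x hx
    obtain ⟨γ, hγ⟩ := exists_coe_eq_neg α
    have hγpos := root_mem_closure_of_isPos (isPos_of_coe_eq_neg hα hγ)
    induction hx using Submodule.iSup_induction' with
    | mem ν x hx =>
      induction hx using Submodule.iSup_induction' with
      | mem hν x hx =>
        refine Submodule.mem_iSup_of_mem (ν + (rootSystem H).root γ)
          (Submodule.mem_iSup_of_mem (add_mem hν hγpos) ?_)
        rw [LieSubmodule.mem_toSubmodule, mem_weightSpace] at hx ⊢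
        intro t
        have h1 : ⁅t, x⁆ = ⁅(t : L), x⁆ := rfl
        have h2 := hx t
        have h3 : ⁅(t : L), z⁆ = α.1 t • z := lie_eq_smul_of_mem_rootSpace hz t
        have h4 : γ.1 t = -α.1 t := congrFun hγ t
        change ⁅(t : L), ⁅z, x⁆⁆ = _
        rw [leibniz_lie, h3, ← h1, h2, lie_smul, smul_lie, ← add_smul]
        congr 1
        simp only [Pi.sub_apply, LinearMap.add_apply, rootSystem_root_apply]
        change _ = lam t - (ν t + γ.1 t)
        rw [h4]
        ring
      | zero => simp
      | add x y _ _ hx hy =>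
        rw [map_add]
        exact add_mem hx hy
    | zero => simp
    | add x y _ _ hx hy =>
      rw [map_add]
      exact add_mem hx hy

theorem sub_mem_closure_of_mem_cyclicSpan (hv : IsHighestWeightVector b lam v)
    (ha : IsHighestWeightVector b μ a) (hav : a ∈ cyclicSpan b v) :
    lam - μ ∈ AddSubmonoid.closure ((rootSystem H).root '' (b.support : Set H.root)) := by
  by_contra hc
  apply ha.ne_zero
  have h1 : a ∈ (genWeightSpace V (μ : H → ℂ)).toSubmodule := by
    refine weightSpace_le_genWeightSpace V (μ : H → ℂ) ?_
    rw [mem_weightSpace]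
    exact ha.lie_cartan
  have hind := LieSubmodule.iSupIndep_toSubmodule.2 (iSupIndep_genWeightSpace ℂ H V)
  refine Submodule.disjoint_def.1 (hind (μ : H → ℂ)) a h1 ?_
  refine iSup₂_le (a := ⨆ χ, ⨆ (_ : χ ≠ (μ : H → ℂ)), (genWeightSpace V χ).toSubmodule)
    (fun ν hν => ?_) (hv.cyclicSpan_le_iSup_weightSpace hav)
  refine le_trans ?_ (le_iSup₂_of_le (lam - ν : H → ℂ) ?_ le_rfl)
  · exact weightSpace_le_genWeightSpace V _
  · intro h
    apply hc
    have : lam - μ = ν := by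
      ext t
      have := congrFun h t
      simp only [Pi.sub_apply] at this
      rw [LinearMap.sub_apply, ← this]
      ring
    rw [this]
    exact hν

theorem casimir_apply_of_mem_cyclicSpan (hv : IsHighestWeightVector b lam v)
    (X : DualRootVectors H) (hav : a ∈ cyclicSpan b v) :
    casimir X V a = casimirValue b lam • a := by
  have h : cyclicSpan b v ≤ LinearMap.ker (casimir X V - casimirValue b lam • 1) := by
    refine closureUnder_le ?_ ?_
    · rw [Submodule.span_singleton_le_iff_mem]
      simp [hv.casimir_apply X]
    · rintro _ ⟨α, -, z, -, rfl⟩ x hx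
      simp only [LinearMap.mem_ker, LinearMap.sub_apply, LinearMap.smul_apply,
        Module.End.one_apply, sub_eq_zero] at hx ⊢
      rw [toEnd_apply_apply, casimir_lie, hx, lie_smul]
  simpa [sub_eq_zero] using h hav

/-- For each simple root, `a` is a primitive vector of the corresponding `sl₂`, whose weight in a
finite-dimensional module is a natural number. -/
theorem isDominant {U : LieSubmodule ℂ L V} [FiniteDimensional ℂ U]
    (ha : IsHighestWeightVector b μ a) (haU : a ∈ U) : IsDominant b μ := by
  intro i hi
  obtain ⟨h, e, f, ht, he, hf⟩ :=
    exists_isSl2Triple_of_weight_isNonZero (LieSubalgebra.isNonZero_coe_root i)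
  have hh := ht.h_eq_coroot (LieSubalgebra.isNonZero_coe_root i) he hf
  have P : ht.HasPrimitiveVectorWith (⟨a, haU⟩ : U) (μ (coroot i.1)) :=
    { ne_zero := fun h => ha.ne_zero (congrArg Subtype.val h)
      lie_h := by
        apply Subtype.ext
        change ⁅h, a⁆ = _
        rw [hh, ha.lie_cartan]
        rfl
      lie_e := by
        apply Subtype.ext
        change ⁅e, a⁆ = 0
        exact ha.lie_pos i (RootPairing.Base.isPos_of_mem_support hi) e he }
  exact P.exists_nat

/-- In a finite-dimensional representation, the only highest weight vectors in the subrepresentation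
generated by a highest weight vector `v` are the multiples of `v`. -/
theorem mem_span_of_mem_cyclicSpan {U : LieSubmodule ℂ L V} [FiniteDimensional ℂ U]
    (hv : IsHighestWeightVector b lam v) (hvU : v ∈ U) (ha : IsHighestWeightVector b μ a)
    (hav : a ∈ cyclicSpan b v) : a ∈ Submodule.span ℂ {v} := by
  obtain ⟨X⟩ : Nonempty (DualRootVectors H) := inferInstance
  -- The Casimir operator acts on the whole span by the scalar of `v`, so `a` has the same scalar
  -- and hence the same weight. Lowering operators strictly lower the eigenvalue of the height
  -- element `d`, so only the line of `v` has that weight.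
  have h1 := hv.casimir_apply_of_mem_cyclicSpan X hav
  rw [ha.casimir_apply X] at h1
  have h2 : casimirValue b μ = casimirValue b lam := smul_left_injective ℂ ha.ne_zero h1
  have h3 := eq_of_casimirValue_eq (hv.isDominant hvU) (ha.isDominant (cyclicSpan_le hvU hav))
    (hv.sub_mem_closure_of_mem_cyclicSpan ha hav) h2.symm
  subst h3
  obtain ⟨d, hd⟩ := exists_forall_root_apply_eq_height b
  refine mem_span_singleton_of_mem_closureUnder (D := toEnd ℂ L V d) (c := lam d)
    (hv.lie_cartan d) ?_ hav (ha.lie_cartan d)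
  rintro _ ⟨α, hα, z, hz, rfl⟩
  obtain ⟨n, hn⟩ := height_neg_of_not_isPos hα
  refine ⟨n, fun x => ?_⟩
  have h3 : ⁅(d : L), z⁆ = α.1 d • z := lie_eq_smul_of_mem_rootSpace hz d
  rw [toEnd_apply_apply, toEnd_apply_apply, toEnd_apply_apply, toEnd_apply_apply, leibniz_lie, h3,
    hd, hn, smul_lie, neg_smul]
  abel

end IsHighestWeightVector

/-- A nonzero finite-dimensional subspace of a representation that is stable under the Cartan
subalgebra and under the positive root vectors contains a highest weight vector. -/
theorem exists_isHighestWeightVector_mem {b : (rootSystem H).Base} {Y : Submodule ℂ V}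
    [FiniteDimensional ℂ Y] (hY : Y ≠ ⊥) (hH : ∀ t : H, ∀ x ∈ Y, ⁅(t : L), x⁆ ∈ Y)
    (hpos : ∀ α : H.root, b.IsPos α → ∀ z ∈ rootSpace H α.1, ∀ x ∈ Y, ⁅z, x⁆ ∈ Y) :
    ∃ μ, ∃ a ∈ Y, IsHighestWeightVector b μ a := by
  obtain ⟨d, hd⟩ := exists_forall_root_apply_eq_height b
  let D : Module.End ℂ Y := (toEnd ℂ L V d).restrict (hH d)
  have : Nontrivial Y := Submodule.nontrivial_iff_ne_bot.2 hY
  obtain ⟨c₀, hc₀⟩ := Module.End.exists_eigenvalue D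
  -- An eigenvalue of maximal real part. Positive root vectors raise eigenvalues of `d` by positive
  -- integers, so they kill its eigenspace; the Cartan subalgebra preserves this eigenspace and has
  -- a weight vector in it.
  obtain ⟨c, hc, hcmax⟩ : ∃ c, D.HasEigenvalue c ∧ ∀ n : ℕ, ¬ D.HasEigenvalue (c + (n + 1)) := by
    by_contra! hcon
    have hfin := D.finite_hasEigenvalue
    obtain ⟨c, hc, hmax⟩ := Set.exists_max_image _ Complex.re hfin ⟨c₀, hc₀⟩
    obtain ⟨n, hn⟩ := hcon c hc
    have := hmax _ hn
    simp at this
    linarith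
  let E : LieSubmodule ℂ H V :=
    { Y ⊓ (toEnd ℂ L V d).eigenspace c with
      lie_mem := by
        intro t x hx
        obtain ⟨hx1, hx2⟩ := Submodule.mem_inf.1 hx
        refine Submodule.mem_inf.2 ⟨hH t x hx1, ?_⟩
        rw [Module.End.mem_eigenspace_iff, toEnd_apply_apply] at hx2 ⊢
        change ⁅(d : L), ⁅(t : L), x⁆⁆ = c • ⁅(t : L), x⁆
        have h0 : ⁅(d : L), (t : L)⁆ = 0 := by
          have := LieModule.IsTrivial.trivial d t
          exact congrArg Subtype.val this
        rw [leibniz_lie, h0, zero_lie, zero_add, hx2, lie_smul] }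
  have hmem : ∀ x, x ∈ E ↔ x ∈ Y ∧ ⁅(d : L), x⁆ = c • x := by
    intro x
    change x ∈ Y ⊓ (toEnd ℂ L V d).eigenspace c ↔ _
    rw [Submodule.mem_inf, Module.End.mem_eigenspace_iff, toEnd_apply_apply]
  have hEY : E.toSubmodule ≤ Y := inf_le_left
  have : FiniteDimensional ℂ E.toSubmodule := Submodule.finiteDimensional_of_le hEY
  have : Module.Finite ℂ E := this
  have : Nontrivial E := by
    obtain ⟨⟨x, hx⟩, hxD⟩ := hc.exists_hasEigenvector
    refine ⟨⟨⟨x, (hmem x).2 ⟨hx, congrArg Subtype.val hxD.apply_eq_smul⟩⟩, 0, fun h => ?_⟩⟩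
    exact hxD.2 (Subtype.ext (congrArg (Subtype.val : E → V) h))
  obtain ⟨μ, hμ⟩ := exists_nontrivial_weightSpace_of_isNilpotent ℂ H E
  obtain ⟨⟨⟨a, haE⟩, ha⟩, hne⟩ := exists_ne (0 : weightSpace E (μ : H → ℂ))
  obtain ⟨haY, had⟩ := (hmem a).1 haE
  rw [mem_weightSpace] at ha
  refine ⟨μ, a, haY, fun h => hne (Subtype.ext (Subtype.ext h)),
    fun t => congrArg Subtype.val (ha t), fun α hα z hz => ?_⟩
  by_contra hza
  have hzY := hpos α hα z hz a haY
  obtain ⟨n, hn⟩ : ∃ n : ℕ, b.height α = n + 1 := by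
    rw [RootPairing.Base.isPos_iff] at hα
    exact ⟨(b.height α - 1).toNat, by lia⟩
  refine hcmax n (Module.End.hasEigenvalue_of_hasEigenvector (x := ⟨⁅z, a⁆, hzY⟩) ?_)
  rw [Module.End.hasEigenvector_iff, Module.End.mem_eigenspace_iff]
  refine ⟨Subtype.ext ?_, fun h => hza (congrArg Subtype.val h)⟩
  change ⁅(d : L), ⁅z, a⁆⁆ = (c + (n + 1)) • ⁅z, a⁆
  have h3 : ⁅(d : L), z⁆ = α.1 d • z := lie_eq_smul_of_mem_rootSpace hz d
  rw [leibniz_lie, h3, hd, hn, had, lie_smul, smul_lie, ← add_smul]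
  congr 1
  push_cast
  ring

/-- A highest weight vector in a finite-dimensional representation generates an irreducible
subrepresentation. -/
theorem IsHighestWeightVector.exists_isIrreducibleWithHighestWeight {b : (rootSystem H).Base}
    {lam : Module.Dual ℂ H} {v : V} {U : LieSubmodule ℂ L V} [FiniteDimensional ℂ U]
    (hv : IsHighestWeightVector b lam v) (hvU : v ∈ U) :
    ∃ W : LieSubmodule ℂ L V, W ≤ U ∧ IsIrreducibleWithHighestWeight b W lam := by
  let W : LieSubmodule ℂ L V :=
    { cyclicSpan b v with lie_mem := fun {z x} hx => hv.lie_mem_cyclicSpan z hx }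
  have hWU : W ≤ U := cyclicSpan_le hvU
  have hvW : v ∈ W := mem_cyclicSpan_self b v
  refine ⟨W, hWU, ?_, v, hvW, hv⟩
  have : Nontrivial W :=
    ⟨⟨⟨v, hvW⟩, 0, fun h => hv.ne_zero (congrArg Subtype.val h)⟩⟩
  refine LieModule.IsIrreducible.mk fun N hN => ?_
  let Y : Submodule ℂ V := N.toSubmodule.map W.toSubmodule.subtype
  have hYU : Y ≤ U.toSubmodule := by
    rintro _ ⟨y, -, rfl⟩
    exact hWU y.2
  have : FiniteDimensional ℂ U.toSubmodule := ‹FiniteDimensional ℂ U›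
  have : FiniteDimensional ℂ Y := Submodule.finiteDimensional_of_le hYU
  have hlie : ∀ z : L, ∀ x ∈ Y, ⁅z, x⁆ ∈ Y := by
    rintro z _ ⟨y, hy, rfl⟩
    exact ⟨(⁅z, (y : W)⁆ : W), N.lie_mem hy, rfl⟩
  have hY : Y ≠ ⊥ := by
    intro h
    apply hN
    rw [LieSubmodule.eq_bot_iff]
    intro y hy
    have : (y : V) ∈ Y := ⟨y, hy, rfl⟩
    rw [h] at this
    exact Subtype.ext this
  -- A nonzero submodule contains a highest weight vector, which must be a multiple of `v`; so the
  -- submodule contains `v` and everything `v` generates.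
  obtain ⟨μ, a, ⟨y, hy, rfl⟩, ha⟩ := exists_isHighestWeightVector_mem (b := b) hY
    (fun t => hlie t) (fun α _ z _ => hlie z)
  have hspan := hv.mem_span_of_mem_cyclicSpan hvU ha y.2
  obtain ⟨c, hc⟩ := Submodule.mem_span_singleton.1 hspan
  have hc0 : c ≠ 0 := by
    rintro rfl
    exact ha.ne_zero (by rw [← hc, zero_smul])
  have hvN : v ∈ Y := by
    have : v = c⁻¹ • W.toSubmodule.subtype y := by rw [← hc, smul_smul, inv_mul_cancel₀ hc0, one_smul]
    rw [this]
    exact Submodule.smul_mem _ _ ⟨y, hy, rfl⟩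
  have hle : cyclicSpan b v ≤ Y := by
    refine closureUnder_le (by simpa using hvN) ?_
    rintro _ ⟨α, -, z, -, rfl⟩ x hx
    exact hlie z x hx
  refine eq_top_iff.2 fun w _ => ?_
  obtain ⟨y', hy', h⟩ := hle w.2
  have : y' = w := Subtype.ext h
  rwa [← this]

end SymLie

namespace SymLie

open LieAlgebra LieAlgebra.IsKilling LieModule

/-! ### Powers of subspaces in the symmetric algebra -/

section SymmetricPower

variable {R L M : Type*} [CommRing R] [LieRing L] [LieAlgebra R L]
  [AddCommGroup M] [Module R M] [LieRingModule L M] [LieModule R L M]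

theorem lie_algebraMap (x : L) (r : R) :
    ⁅x, algebraMap R (SymmetricAlgebra R M) r⁆ = 0 :=
  (symHom R L M x).map_algebraMap r

theorem map_ι_pow_le_symPow (G : Submodule R M) (n : ℕ) :
    G.map (SymmetricAlgebra.ι R M) ^ n ≤ (symPow R L M n).toSubmodule :=
  pow_left_mono n LinearMap.map_le_range

instance [Module.Finite R M] (n : ℕ) : Module.Finite R (symPow R L M n) :=
  Module.Finite.iff_fg.2 (Submodule.FG.pow
    (Module.Finite.iff_fg.1 (Module.Finite.range (SymmetricAlgebra.ι R M))) n)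

theorem lie_mem_map_ι_pow {G : Submodule R M} {z : L} (hz : ∀ x ∈ G, ⁅z, x⁆ ∈ G) {n : ℕ}
    {a : SymmetricAlgebra R M} (ha : a ∈ G.map (SymmetricAlgebra.ι R M) ^ n) :
    ⁅z, a⁆ ∈ G.map (SymmetricAlgebra.ι R M) ^ n := by
  induction n generalizing a with
  | zero =>
    rw [pow_zero] at ha
    obtain ⟨r, rfl⟩ := Submodule.mem_one.1 ha
    rw [lie_algebraMap]
    exact zero_mem _
  | succ n ih =>
    rw [pow_succ] at ha ⊢
    induction ha using Submodule.mul_induction_on' with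
    | mem_mul_mem a ha y hy =>
      rw [lie_mul]
      refine add_mem (Submodule.mul_mem_mul (ih ha) hy) (Submodule.mul_mem_mul ha ?_)
      obtain ⟨x, hx, rfl⟩ := hy
      exact ⟨⁅z, x⁆, hz x hx, (lie_ι z x).symm⟩
    | add a _ c _ ha hc =>
      rw [lie_add]
      exact add_mem ha hc

theorem lie_eq_zero_of_mem_map_ι_pow {G : Submodule R M} {z : L} (hz : ∀ x ∈ G, ⁅z, x⁆ = 0)
    {n : ℕ} {a : SymmetricAlgebra R M} (ha : a ∈ G.map (SymmetricAlgebra.ι R M) ^ n) :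
    ⁅z, a⁆ = 0 := by
  induction n generalizing a with
  | zero =>
    rw [pow_zero] at ha
    obtain ⟨r, rfl⟩ := Submodule.mem_one.1 ha
    exact lie_algebraMap z r
  | succ n ih =>
    rw [pow_succ] at ha
    induction ha using Submodule.mul_induction_on' with
    | mem_mul_mem a ha y hy =>
      obtain ⟨x, hx, rfl⟩ := hy
      rw [lie_mul, ih ha, lie_ι, hz x hx, map_zero, zero_mul, mul_zero, add_zero]
    | add a _ c _ ha hc => rw [lie_add, ha, hc, add_zero]

theorem algHom_eq_of_mem_map_ι_pow {A : Type*} [CommRing A] [Algebra R A]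
    {f g : SymmetricAlgebra R M →ₐ[R] A} {G : Submodule R M}
    (h : ∀ x ∈ G, f (SymmetricAlgebra.ι R M x) = g (SymmetricAlgebra.ι R M x))
    {n : ℕ} {a : SymmetricAlgebra R M} (ha : a ∈ G.map (SymmetricAlgebra.ι R M) ^ n) :
    f a = g a := by
  induction n generalizing a with
  | zero =>
    rw [pow_zero] at ha
    obtain ⟨r, rfl⟩ := Submodule.mem_one.1 ha
    simp
  | succ n ih =>
    rw [pow_succ] at ha
    induction ha using Submodule.mul_induction_on' with
    | mem_mul_mem a ha y hy =>
      obtain ⟨x, hx, rfl⟩ := hy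
      rw [map_mul, map_mul, ih ha, h x hx]
    | add a _ c _ ha hc => rw [map_add, map_add, ha, hc]

end SymmetricPower

/-! ### Elements of the symmetric algebra as polynomial functions -/

section Evaluation

variable {L : Type*} [LieRing L] [LieAlgebra ℂ L]

/-- Evaluation of elements of `S L`, viewed as polynomial functions on `L` by means of the Killing
form, at a point `E`. -/
noncomputable def evalAt (E : L) : SymmetricAlgebra ℂ L →ₐ[ℂ] ℂ :=
  SymmetricAlgebra.lift (killingForm ℂ L E)

theorem evalAt_ι (E x : L) : evalAt E (SymmetricAlgebra.ι ℂ L x) = killingForm ℂ L E x := by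
  simp [evalAt]

/-- By invariance of the Killing form, `z` acts on functions as a vector field whose value at `E` is
`⁅z, E⁆` up to sign. -/
theorem evalAt_lie {E z : L} (h : ⁅z, E⁆ = 0) (a : SymmetricAlgebra ℂ L) :
    evalAt E ⁅z, a⁆ = 0 := by
  induction a using SymmetricAlgebra.induction with
  | algebraMap r => rw [lie_algebraMap, map_zero]
  | ι x =>
    rw [lie_ι, evalAt_ι]
    have h1 : killingForm ℂ L ⁅z, E⁆ x = -killingForm ℂ L E ⁅z, x⁆ :=
      LieModule.traceForm_apply_lie_apply' ℂ L L z E x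
    rw [h] at h1
    simpa using h1
  | mul a c ha hc => rw [lie_mul, map_add, map_mul, map_mul, ha, hc, zero_mul, mul_zero, add_zero]
  | add a c ha hc => rw [lie_add, map_add, ha, hc, add_zero]

end Evaluation

/-- The first projection is injective on `N`. A left inverse of it, defined on all of `V`, followed
by the second projection is the required map. -/
theorem exists_linearMap_of_graph {K V W : Type*} [Field K] [AddCommGroup V] [Module K V]
    [AddCommGroup W] [Module K W] {N : Submodule K (V × W)} (hN : ∀ a, (0, a) ∈ N → a = 0) :
    ∃ φ : V →ₗ[K] W, ∀ p ∈ N, φ p.1 = p.2 := by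
  obtain ⟨g, hg⟩ := (LinearMap.fst K V W ∘ₗ N.subtype).exists_leftInverse_of_injective (by
    rw [LinearMap.ker_eq_bot']
    rintro ⟨⟨x, a⟩, hp⟩ hx
    obtain rfl : x = 0 := hx
    obtain rfl := hN a hp
    rfl)
  refine ⟨LinearMap.snd K V W ∘ₗ N.subtype ∘ₗ g, fun p hp => ?_⟩
  have := congrArg (fun q : N => q.1.2) (LinearMap.congr_fun hg ⟨p, hp⟩)
  exact this

/-! ### The graded pieces of degree two and minus two -/

section DegreeSpaces

variable {L : Type*} [LieRing L] [LieAlgebra ℂ L] [FiniteDimensional ℂ L] [IsKilling ℂ L]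
  {H : LieSubalgebra ℂ L} [H.IsCartanSubalgebra]

theorem coe_pairingIn (α γ : H.root) :
    ((rootSystem H).pairingIn ℤ α γ : ℂ) = α.1 (coroot γ.1) := by
  rw [intCast_pairingIn, rootSystem_pairing_apply]

/-- The sum of the coroots of the roots `β i`, `i ∈ s`. -/
noncomputable def corootSum (β : ℕ → H.root) (s : Finset ℕ) : H := ∑ i ∈ s, coroot (β i).1

theorem root_apply_corootSum' (β : ℕ → H.root) (s : Finset ℕ) (γ : H.root) :
    γ.1 (corootSum β s) = ((∑ i ∈ s, (rootSystem H).pairingIn ℤ γ (β i) : ℤ) : ℂ) := by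
  have : γ.1 (corootSum β s) = Weight.toLinear ℂ H L γ.1 (corootSum β s) := rfl
  rw [this, corootSum, map_sum, Int.cast_sum]
  refine Finset.sum_congr rfl fun i _ => ?_
  rw [coe_pairingIn]
  rfl

theorem root_apply_corootSum (β : ℕ → H.root) (s : Finset ℕ) (γ : H.root) :
    γ.1 (corootSum β s) = (cascadeDegree (rootSystem H) β s γ : ℂ) :=
  root_apply_corootSum' β s γ

/-- The span of the root spaces of degree two. -/
def topSpace (β : ℕ → H.root) (s : Finset ℕ) : Submodule ℂ L :=
  Submodule.span ℂ {z | ∃ γ, cascadeDegree (rootSystem H) β s γ = 2 ∧ z ∈ rootSpace H γ.1}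

/-- The span of the root spaces of degree minus two. -/
def bottomSpace (β : ℕ → H.root) (s : Finset ℕ) : Submodule ℂ L :=
  Submodule.span ℂ {z | ∃ γ, cascadeDegree (rootSystem H) β s γ = 2 ∧
    z ∈ rootSpace H (-(γ.1 : H → ℂ))}

variable {β : ℕ → H.root} {s : Finset ℕ}

theorem cascadeDegree_eq_neg_of_coe_eq_neg {γ δ : H.root} (h : (δ.1 : H → ℂ) = -(γ.1 : H → ℂ)) :
    cascadeDegree (rootSystem H) β s δ = -cascadeDegree (rootSystem H) β s γ := by
  have h1 := congrFun h (corootSum β s)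
  rw [Pi.neg_apply, root_apply_corootSum, root_apply_corootSum] at h1
  exact_mod_cast h1

/-- A homogeneous element of degree `m ≠ 0` is zero or a root vector. -/
theorem eq_zero_or_exists_root_of_degree {χ : H → ℂ} {z : L} (hz : z ∈ rootSpace H χ) {m : ℤ}
    (hm : χ (corootSum β s) = m) (hm0 : m ≠ 0) :
    z = 0 ∨ ∃ α : H.root, χ = α.1 ∧ cascadeDegree (rootSystem H) β s α = m := by
  rcases eq_zero_or_mem_or_exists_root hz with h | ⟨h, -⟩ | ⟨α, rfl⟩
  · exact Or.inl h
  · rw [h, Pi.zero_apply] at hm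
    exact absurd (by exact_mod_cast hm.symm) hm0
  · refine Or.inr ⟨α, rfl, ?_⟩
    rw [root_apply_corootSum] at hm
    exact_mod_cast hm

theorem eq_zero_of_two_lt_abs_degree (hd : ∀ γ, cascadeDegree (rootSystem H) β s γ ≤ 2)
    {χ : H → ℂ} {z : L} (hz : z ∈ rootSpace H χ) {m : ℤ}
    (hm : χ (corootSum β s) = m) (hm2 : 2 < |m|) : z = 0 := by
  refine (eq_zero_or_exists_root_of_degree hz hm ?_).resolve_right ?_
  · rintro rfl
    simp at hm2
  · rintro ⟨α, -, hα⟩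
    obtain ⟨γ, hγ⟩ := exists_coe_eq_neg α
    have h1 := hd α
    have h2 := hd γ
    rw [cascadeDegree_eq_neg_of_coe_eq_neg hγ] at h2
    rcases abs_cases m with h | h <;> lia

theorem lie_mem_topSpace {χ : H → ℂ} (hχ : χ (corootSum β s) = 0) {z : L}
    (hz : z ∈ rootSpace H χ) {x : L} (hx : x ∈ topSpace β s) : ⁅z, x⁆ ∈ topSpace β s := by
  induction hx using Submodule.span_induction with
  | mem x hx =>
    obtain ⟨γ, hγ, hx⟩ := hx
    have h := lie_mem_rootSpace_add hz hx
    rcases eq_zero_or_exists_root_of_degree (β := β) (s := s) (m := 2) h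
      (by rw [Pi.add_apply, hχ, root_apply_corootSum, hγ, zero_add]) two_ne_zero with
      h0 | ⟨δ, hδ, hδ2⟩
    · rw [h0]; exact zero_mem _
    · rw [hδ] at h
      exact Submodule.subset_span ⟨δ, hδ2, h⟩
  | zero => simp
  | add x y _ _ hx hy => rw [lie_add]; exact add_mem hx hy
  | smul c x _ hx => rw [lie_smul]; exact Submodule.smul_mem _ _ hx

theorem lie_mem_bottomSpace {χ : H → ℂ} (hχ : χ (corootSum β s) = 0) {z : L}
    (hz : z ∈ rootSpace H χ) {x : L} (hx : x ∈ bottomSpace β s) : ⁅z, x⁆ ∈ bottomSpace β s := by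
  induction hx using Submodule.span_induction with
  | mem x hx =>
    obtain ⟨γ, hγ, hx⟩ := hx
    have h := lie_mem_rootSpace_add hz hx
    rcases eq_zero_or_exists_root_of_degree (β := β) (s := s) (m := -2) h
      (by rw [Pi.add_apply, hχ, Pi.neg_apply, root_apply_corootSum, hγ, zero_add]; simp)
      (by simp) with h0 | ⟨δ, hδ, hδ2⟩
    · rw [h0]; exact zero_mem _
    · rw [hδ] at h
      obtain ⟨ε, hε⟩ := exists_coe_eq_neg δ
      refine Submodule.subset_span ⟨ε, ?_, by rwa [hε, neg_neg]⟩
      rw [cascadeDegree_eq_neg_of_coe_eq_neg hε, hδ2, neg_neg]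
  | zero => simp
  | add x y _ _ hx hy => rw [lie_add]; exact add_mem hx hy
  | smul c x _ hx => rw [lie_smul]; exact Submodule.smul_mem _ _ hx

theorem lie_eq_zero_of_mem_topSpace (hd : ∀ γ, cascadeDegree (rootSystem H) β s γ ≤ 2)
    {α : H.root} (hα : 0 < cascadeDegree (rootSystem H) β s α) {z : L}
    (hz : z ∈ rootSpace H α.1) {x : L} (hx : x ∈ topSpace β s) : ⁅z, x⁆ = 0 := by
  induction hx using Submodule.span_induction with
  | mem x hx =>
    obtain ⟨γ, hγ, hx⟩ := hx
    refine eq_zero_of_two_lt_abs_degree hd (lie_mem_rootSpace_add hz hx)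
      (m := cascadeDegree (rootSystem H) β s α + 2) ?_ (lt_of_lt_of_le (by lia) (le_abs_self _))
    rw [Pi.add_apply, root_apply_corootSum, root_apply_corootSum, hγ]
    push_cast
    rfl
  | zero => simp
  | add x y _ _ hx hy => rw [lie_add, hx, hy, add_zero]
  | smul c x _ hx => rw [lie_smul, hx, smul_zero]

theorem lie_eq_zero_of_mem_bottomSpace (hd : ∀ γ, cascadeDegree (rootSystem H) β s γ ≤ 2)
    {α : H.root} (hα : cascadeDegree (rootSystem H) β s α < 0) {z : L}
    (hz : z ∈ rootSpace H α.1) {x : L} (hx : x ∈ bottomSpace β s) : ⁅z, x⁆ = 0 := by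
  induction hx using Submodule.span_induction with
  | mem x hx =>
    obtain ⟨γ, hγ, hx⟩ := hx
    refine eq_zero_of_two_lt_abs_degree hd (lie_mem_rootSpace_add hz hx)
      (m := cascadeDegree (rootSystem H) β s α - 2) ?_
      (lt_of_lt_of_le (by lia) (neg_le_abs _))
    rw [Pi.add_apply, Pi.neg_apply, root_apply_corootSum, root_apply_corootSum, hγ]
    push_cast
    ring
  | zero => simp
  | add x y _ _ hx hy => rw [lie_add, hx, hy, add_zero]
  | smul c x _ hx => rw [lie_smul, hx, smul_zero]

theorem lie_corootSum_of_mem_bottomSpace {x : L} (hx : x ∈ bottomSpace β s) :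
    ⁅(corootSum β s : L), x⁆ = (-2 : ℂ) • x := by
  induction hx using Submodule.span_induction with
  | mem x hx =>
    obtain ⟨γ, hγ, hx⟩ := hx
    have h : ⁅(corootSum β s : L), x⁆ = -γ.1 (corootSum β s) • x :=
      lie_eq_smul_of_mem_rootSpace hx (corootSum β s)
    rw [h, root_apply_corootSum, hγ]
    simp
  | zero => simp
  | add x y _ _ hx hy => rw [lie_add, hx, hy, smul_add]
  | smul c x _ hx => rw [lie_smul, hx, smul_comm]

/-- The root spaces of degree minus two form an irreducible module over the centralizer of
`corootSum β s`. -/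
theorem mem_of_mem_bottomSpace [LieAlgebra.IsSimple ℂ L]
    (hd : ∀ γ, cascadeDegree (rootSystem H) β s γ ≤ 2) {Y : Submodule ℂ L} (hY : Y ≠ ⊥)
    (hYb : Y ≤ bottomSpace β s)
    (hstab : ∀ χ : H → ℂ, χ (corootSum β s) = 0 → ∀ z ∈ rootSpace H χ, ∀ y ∈ Y, ⁅z, y⁆ ∈ Y)
    {x : L} (hx : x ∈ bottomSpace β s) : x ∈ Y := by
  -- The closure of `Y` under the root vectors of positive degree is an ideal, because degree zero
  -- preserves `Y` and negative degree kills it. By simplicity it is all of `L`.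
  let T : Set (Module.End ℂ L) := {f | ∃ α : H.root, 0 < cascadeDegree (rootSystem H) β s α ∧
    ∃ z ∈ rootSpace H α.1, f = ad ℂ L z}
  have hJ : ∀ z : L, ∀ x ∈ closureUnder Y T, ⁅z, x⁆ ∈ closureUnder Y T := by
    intro z x hx
    induction z using rootSpace_induction (H := H) with
    | zero => simp
    | add y z hy hz => rw [add_lie]; exact add_mem hy hz
    | mem χ z hz =>
      refine map_mem_closureUnder_of_commutator
        (G := {f | ∃ χ : H → ℂ, ∃ z ∈ rootSpace H χ, f = ad ℂ L z}) ?_ ?_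
        (g := ad ℂ L z) ⟨χ, z, hz, rfl⟩ hx
      · rintro _ ⟨χ, z, hz, rfl⟩ y hy
        rw [ad_apply]
        rcases eq_zero_or_mem_or_exists_root hz with rfl | ⟨rfl, hH⟩ | ⟨α, rfl⟩
        · simp
        · exact le_closureUnder (hstab 0 rfl z hz y hy)
        · rcases lt_trichotomy (cascadeDegree (rootSystem H) β s α) 0 with h | h | h
          · rw [lie_eq_zero_of_mem_bottomSpace hd h hz (hYb hy)]
            exact zero_mem _
          · refine le_closureUnder (hstab α.1 ?_ z hz y hy)
            rw [root_apply_corootSum, h, Int.cast_zero]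
          · exact map_mem_closureUnder (T := T) (f := ad ℂ L z) ⟨α, h, z, hz, rfl⟩
              (le_closureUnder hy)
      · rintro _ ⟨χ, z, hz, rfl⟩ _ ⟨α, -, y, hy, rfl⟩
        exact ⟨_, ⟨_, _, lie_mem_rootSpace_add hz hy, rfl⟩, fun x => by simp⟩
  let J : LieIdeal ℂ L := { closureUnder Y T with lie_mem := fun {z x} hx => hJ z x hx }
  have hJtop : J = ⊤ := by
    refine (LieAlgebra.IsSimple.eq_bot_or_eq_top J).resolve_left fun h => hY ?_
    rw [eq_bot_iff]
    intro y hy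
    have : y ∈ J := le_closureUnder hy
    rw [h] at this
    exact this
  -- The degrees above -2. Operators in `T` raise degrees, so the part of degree -2 of the ideal is
  -- just `Y`.
  let Up : Submodule ℂ L := ⨆ m : ℕ, (ad ℂ L (corootSum β s : L)).eigenspace ((m : ℂ) + 1 - 2)
  have hle : closureUnder Y T ≤ Y ⊔ Up := by
    refine closureUnder_le le_sup_left ?_
    rintro _ ⟨α, hα, z, hz, rfl⟩ x hx
    obtain ⟨n, hn⟩ : ∃ n : ℕ, cascadeDegree (rootSystem H) β s α = n + 1 :=
      ⟨(cascadeDegree (rootSystem H) β s α - 1).toNat, by lia⟩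
    have h3 : ⁅(corootSum β s : L), z⁆ = ((n : ℂ) + 1) • z := by
      have : ⁅(corootSum β s : L), z⁆ = α.1 (corootSum β s) • z :=
        lie_eq_smul_of_mem_rootSpace hz _
      rw [this, root_apply_corootSum, hn]
      simp
    obtain ⟨y, hy, w, hw, rfl⟩ := Submodule.mem_sup.1 hx
    clear hx
    rw [map_add]
    refine Submodule.mem_sup_right (add_mem ?_ ?_)
    · refine Submodule.mem_iSup_of_mem n (Module.End.mem_eigenspace_iff.2 ?_)
      rw [ad_apply, ad_apply, leibniz_lie, h3, lie_corootSum_of_mem_bottomSpace (hYb hy), lie_smul,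
        smul_lie, ← add_smul]
      congr 1
    · induction hw using Submodule.iSup_induction' with
      | mem m w hw =>
        refine Submodule.mem_iSup_of_mem (n + m + 1) (Module.End.mem_eigenspace_iff.2 ?_)
        rw [Module.End.mem_eigenspace_iff, ad_apply] at hw
        rw [ad_apply, ad_apply, leibniz_lie, h3, hw, lie_smul, smul_lie, ← add_smul]
        congr 1
        push_cast
        ring
      | zero => simp
      | add w w' _ _ hw hw' => rw [map_add]; exact add_mem hw hw'
  have hxJ : x ∈ J := by rw [hJtop]; trivial
  obtain ⟨y, hy, w, hw, rfl⟩ := Submodule.mem_sup.1 (hle hxJ)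
  have hw1 : w ∈ (ad ℂ L (corootSum β s : L)).eigenspace (-2) := by
    rw [Module.End.mem_eigenspace_iff, ad_apply]
    have h1 := lie_corootSum_of_mem_bottomSpace hx
    rw [lie_add, lie_corootSum_of_mem_bottomSpace (hYb hy), smul_add] at h1
    exact add_left_cancel h1
  have hw2 : w ∈ ⨆ c, ⨆ (_ : c ≠ (-2 : ℂ)), (ad ℂ L (corootSum β s : L)).eigenspace c := by
    refine (iSup_le fun m => ?_ : Up ≤ _) hw
    refine le_iSup₂_of_le ((m : ℂ) + 1 - 2) (fun h => ?_) le_rfl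
    have : (m : ℂ) + 1 = 0 := by linear_combination h
    exact Nat.cast_add_one_ne_zero m this
  have : w = 0 := Submodule.disjoint_def.1
    ((ad ℂ L (corootSum β s : L)).eigenspaces_iSupIndep (-2)) w hw1 hw2
  rwa [this, add_zero]

end DegreeSpaces

end SymLie

/-! ### The twisted equivariant map on degree minus two, built as a graph -/

namespace SymLie

open LieAlgebra LieAlgebra.IsKilling LieModule

variable {L : Type*} [LieRing L] [LieAlgebra ℂ L] [FiniteDimensional ℂ L] [IsKilling ℂ L]
  {H : LieSubalgebra ℂ L} [H.IsCartanSubalgebra]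

/-- The sum of the roots `β i`, `i ∈ s`. -/
noncomputable def weightSum (β : ℕ → H.root) (s : Finset ℕ) : Module.Dual ℂ H :=
  ∑ i ∈ s, (rootSystem H).root (β i)

/-- The linear functional on `L` that extends the weight `weightSum β s` by zero on the root
spaces. -/
noncomputable def weightFunctional (β : ℕ → H.root) (s : Finset ℕ) : L →ₗ[ℂ] ℂ :=
  killingForm ℂ L (dualElt (weightSum β s) : L)

/-- The operators by which `z` acts on pairs in `L × S L`, the second component being twisted by
the character `-weightFunctional β s`. -/
noncomputable def pairAction (β : ℕ → H.root) (s : Finset ℕ) (z : L) :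
    Module.End ℂ (L × SymmetricAlgebra ℂ L) :=
  (ad ℂ L z).prodMap
    (toEnd ℂ L (SymmetricAlgebra ℂ L) z - weightFunctional β s z • (1 : Module.End ℂ _))

variable {β : ℕ → H.root} {s : Finset ℕ}

theorem pairAction_apply (z : L) (p : L × SymmetricAlgebra ℂ L) :
    pairAction β s z p = (⁅z, p.1⁆, ⁅z, p.2⁆ - weightFunctional β s z • p.2) :=
  rfl

theorem weightFunctional_coe (t : H) : weightFunctional β s (t : L) = weightSum β s t :=
  killingForm_dualElt _ t

theorem weightFunctional_of_mem_rootSpace {χ : H → ℂ} (hχ : χ ≠ 0) {z : L}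
    (hz : z ∈ rootSpace H χ) : weightFunctional β s z = 0 :=
  killingForm_apply_eq_zero_of_mem_rootSpace_of_add_ne_zero ℂ L H
    (mem_rootSpace_of_mem (Subtype.property _)) hz (by rwa [zero_add])

theorem weightFunctional_root {α : H.root} {z : L} (hz : z ∈ rootSpace H α.1) :
    weightFunctional β s z = 0 :=
  weightFunctional_of_mem_rootSpace (LieSubalgebra.isNonZero_coe_root α) hz

theorem weightSum_apply_coroot (α : H.root) :
    weightSum β s (coroot α.1) = ((∑ i ∈ s, (rootSystem H).pairingIn ℤ (β i) α : ℤ) : ℂ) := by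
  rw [weightSum, LinearMap.sum_apply, Int.cast_sum]
  refine Finset.sum_congr rfl fun i _ => ?_
  rw [coe_pairingIn]
  rfl

/-- A root of degree zero is orthogonal to the sum of the `β i`, so `f` commutes with the dual
element of that sum; invariance of the Killing form gives the rest. This makes the functional a
character of the degree-zero subalgebra, so that twisting by it is compatible with brackets. -/
theorem weightFunctional_lie (hs : IsLongOrthogonal (rootSystem H) β s) {α : H.root}
    (hα : cascadeDegree (rootSystem H) β s α = 0) {f : L} (hf : f ∈ rootSpace H α.1) (z : L) :
    weightFunctional β s ⁅z, f⁆ = 0 := by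
  have h0 : α.1 (dualElt (weightSum β s)) = 0 := by
    have h1 := two_mul_apply_dualElt (weightSum β s) α
    rw [weightSum_apply_coroot, hs.sum_pairingIn_eq_zero_of_cascadeDegree_eq_zero hα, Int.cast_zero,
      mul_zero, apply_dualElt_comm] at h1
    simpa using h1
  have h2 : ⁅(dualElt (weightSum β s) : L), f⁆ = 0 := by
    have h3 : ⁅(dualElt (weightSum β s) : L), f⁆ = α.1 (dualElt (weightSum β s)) • f :=
      lie_eq_smul_of_mem_rootSpace hf _
    rw [h3, h0, zero_smul]
  have h4 : killingForm ℂ L ⁅f, (dualElt (weightSum β s) : L)⁆ z =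
      -killingForm ℂ L (dualElt (weightSum β s) : L) ⁅f, z⁆ :=
    LieModule.traceForm_apply_lie_apply' ℂ L L f _ z
  rw [← lie_skew, h2, neg_zero, map_zero, LinearMap.zero_apply] at h4
  rw [weightFunctional, ← lie_skew, map_neg, ← h4]

/-- Passing from the sum of the orthogonal long roots `β i`, `i ∈ s`, to the sum over `insert k s`;
both sums are dominant, and `insert k s` contains the index of the highest root. -/
structure IsCascadeStep (b : (rootSystem H).Base) (β : ℕ → H.root) (k : ℕ) (s : Finset ℕ) :
    Prop where
  notMem : k ∉ s
  longOrthogonal : IsLongOrthogonal (rootSystem H) β (insert k s)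
  le_two : ∀ γ, cascadeDegree (rootSystem H) β (insert k s) γ ≤ 2
  nonneg : ∀ α, b.IsPos α → 0 ≤ cascadeDegree (rootSystem H) β (insert k s) α
  nonneg' : ∀ α, b.IsPos α → 0 ≤ cascadeDegree (rootSystem H) β s α

namespace IsCascadeStep

variable {b : (rootSystem H).Base} {k : ℕ}

theorem topSpace_le (h : IsCascadeStep b β k s) : topSpace β s ≤ topSpace β (insert k s) := by
  refine Submodule.span_mono ?_
  rintro z ⟨γ, hγ, hz⟩
  exact ⟨γ, (h.longOrthogonal.cascadeDegree_insert_eq_two h.notMem h.le_two hγ).2, hz⟩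

/-- The lowering operators that commute with the sum of the coroots. -/
def pairLowering (b : (rootSystem H).Base) (β : ℕ → H.root) (s : Finset ℕ) :
    Set (Module.End ℂ (L × SymmetricAlgebra ℂ L)) :=
  {f | ∃ α : H.root, ¬ b.IsPos α ∧ cascadeDegree (rootSystem H) β s α = 0 ∧
    ∃ z ∈ rootSpace H α.1, f = pairAction β s z}

/-- The graph of an equivariant linear map from the root spaces of degree minus two to `S L`. -/
noncomputable def pairSpan (b : (rootSystem H).Base) (X : DualRootVectors H) (β : ℕ → H.root)
    (k : ℕ) (s : Finset ℕ) (F : SymmetricAlgebra ℂ L) : Submodule ℂ (L × SymmetricAlgebra ℂ L) :=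
  closureUnder (Submodule.span ℂ {(X.v (β k), F)}) (pairLowering b β (insert k s))

variable {X : DualRootVectors H} {F : SymmetricAlgebra ℂ L}

theorem self_mem_pairSpan : (X.v (β k), F) ∈ pairSpan b X β k s F :=
  le_closureUnder (Submodule.mem_span_singleton_self _)

/-- The purpose of the twist: it shifts the weight of `F` by minus the sum over `insert k s`, which
leaves `-β k`, the weight of `v (β k)`. -/
theorem pairAction_cartan_self (h : IsCascadeStep b β k s)
    (hF : IsHighestWeightVector b (weightSum β s) F) (t : H) :
    pairAction β (insert k s) (t : L) (X.v (β k), F) = -(β k).1 t • (X.v (β k), F) := by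
  rw [pairAction_apply]
  ext
  · exact lie_eq_smul_of_mem_rootSpace (X.v_mem (β k)) t
  · change ⁅(t : L), F⁆ - weightFunctional β (insert k s) (t : L) • F = -(β k).1 t • F
    rw [hF.lie_cartan, weightFunctional_coe, ← sub_smul, weightSum, weightSum,
      Finset.sum_insert h.notMem, LinearMap.add_apply]
    congr 1
    rw [sub_add_cancel_right]
    rfl

/-- The generator is a highest weight vector for the degree-zero subalgebra. A positive root vector
of degree zero kills `F`, and it kills `v (β k)` because `β k - α` is not a root. Hence lowering
operators alone already generate a module over that subalgebra. -/
theorem pairAction_mem_pairSpan (h : IsCascadeStep b β k s)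
    (hF : IsHighestWeightVector b (weightSum β s) F)
    {χ : H → ℂ} (hχ : χ (corootSum β (insert k s)) = 0) {z : L} (hz : z ∈ rootSpace H χ)
    {p : L × SymmetricAlgebra ℂ L} (hp : p ∈ pairSpan b X β k s F) :
    pairAction β (insert k s) z p ∈ pairSpan b X β k s F := by
  refine map_mem_closureUnder_of_commutator
    (G := {f | ∃ χ : H → ℂ, χ (corootSum β (insert k s)) = 0 ∧
      ∃ z ∈ rootSpace H χ, f = pairAction β (insert k s) z}) ?_ ?_ ⟨χ, hχ, z, hz, rfl⟩ hp
  · rintro _ ⟨χ, hχ, z, hz, rfl⟩ u hu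
    obtain ⟨c, rfl⟩ := Submodule.mem_span_singleton.1 hu
    rw [map_smul]
    refine Submodule.smul_mem _ _ ?_
    rcases eq_zero_or_mem_or_exists_root hz with rfl | ⟨rfl, hH⟩ | ⟨α, rfl⟩
    · have h0 : pairAction β (insert k s) (0 : L) (X.v (β k), F) = 0 := by simp [pairAction_apply]
      rw [h0]
      exact zero_mem _
    · rw [h.pairAction_cartan_self hF ⟨z, hH⟩]
      exact Submodule.smul_mem _ _ (le_closureUnder (Submodule.mem_span_singleton_self _))
    · rw [root_apply_corootSum] at hχ
      have hα : cascadeDegree (rootSystem H) β (insert k s) α = 0 := by exact_mod_cast hχ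
      by_cases hpos : b.IsPos α
      · have h1 : ⁅z, X.v (β k)⁆ = 0 := by
          have hmem := lie_mem_rootSpace_add hz (X.v_mem (β k))
          refine (eq_zero_or_exists_root_of_degree (β := β) (s := insert k s) (m := -2) hmem ?_
            (by simp)).resolve_right ?_
          · rw [Pi.add_apply, Pi.neg_apply, root_apply_corootSum, root_apply_corootSum, hα,
              h.longOrthogonal.cascadeDegree_self (Finset.mem_insert_self k s)]
            simp
          · rintro ⟨δ, hδ, -⟩
            obtain ⟨ε, hε⟩ := exists_coe_eq_neg δ
            refine h.longOrthogonal.root_sub_notMem_of_cascadeDegree h.notMem hα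
              (h.nonneg' α hpos) ⟨ε, ?_⟩
            ext t
            have e1 := congrFun hδ t
            have e2 := congrFun hε t
            simp only [Pi.add_apply, Pi.neg_apply] at e1 e2
            change ε.1 t = (β k).1 t - α.1 t
            rw [e2, ← e1]
            ring
        have h2 : pairAction β (insert k s) z (X.v (β k), F) = 0 := by
          rw [pairAction_apply, weightFunctional_root hz, h1, hF.lie_pos α hpos z hz]
          simp
        rw [h2]
        exact zero_mem _
      · exact map_mem_closureUnder (T := pairLowering b β (insert k s)) ⟨α, hpos, hα, z, hz, rfl⟩
          (le_closureUnder (Submodule.mem_span_singleton_self _))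
  · rintro _ ⟨χ, hχ, z, hz, rfl⟩ _ ⟨α, -, hα, y, hy, rfl⟩
    refine ⟨_, ⟨_, ?_, _, lie_mem_rootSpace_add hz hy, rfl⟩, fun p => ?_⟩
    · rw [Pi.add_apply, hχ, root_apply_corootSum, hα]
      simp
    · simp only [pairAction_apply, weightFunctional_root hy,
        weightFunctional_lie h.longOrthogonal hα hy, zero_smul, sub_zero]
      ext
      · simp
      · simp only [Prod.snd_add, leibniz_lie z y, lie_sub, lie_smul]
        abel

theorem snd_mem_pow (h : IsCascadeStep b β k s) {n : ℕ}
    (hFn : F ∈ (topSpace β s).map (SymmetricAlgebra.ι ℂ L) ^ n)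
    {p : L × SymmetricAlgebra ℂ L} (hp : p ∈ pairSpan b X β k s F) :
    p.2 ∈ (topSpace β (insert k s)).map (SymmetricAlgebra.ι ℂ L) ^ n := by
  have hle : pairSpan b X β k s F ≤
      Submodule.comap (LinearMap.snd ℂ L (SymmetricAlgebra ℂ L))
        ((topSpace β (insert k s)).map (SymmetricAlgebra.ι ℂ L) ^ n) := by
    refine closureUnder_le ?_ ?_
    · rw [Submodule.span_singleton_le_iff_mem]
      exact pow_left_mono n (Submodule.map_mono h.topSpace_le) hFn
    · rintro _ ⟨α, -, hα, z, hz, rfl⟩ p hp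
      change ⁅z, p.2⁆ - weightFunctional β (insert k s) z • p.2 ∈
        (topSpace β (insert k s)).map (SymmetricAlgebra.ι ℂ L) ^ n
      rw [weightFunctional_root hz, zero_smul, sub_zero]
      refine lie_mem_map_ι_pow (fun x hx => lie_mem_topSpace ?_ hz hx) hp
      rw [root_apply_corootSum, hα, Int.cast_zero]
  exact hle hp

theorem snd_mem_cyclicSpan {p : L × SymmetricAlgebra ℂ L} (hp : p ∈ pairSpan b X β k s F) :
    p.2 ∈ cyclicSpan b F := by
  have hle : pairSpan b X β k s F ≤
      Submodule.comap (LinearMap.snd ℂ L (SymmetricAlgebra ℂ L)) (cyclicSpan b F) := by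
    refine closureUnder_le ?_ ?_
    · rw [Submodule.span_singleton_le_iff_mem]
      exact mem_cyclicSpan_self b F
    · rintro _ ⟨α, hneg, -, z, hz, rfl⟩ p hp
      change ⁅z, p.2⁆ - weightFunctional β (insert k s) z • p.2 ∈ cyclicSpan b F
      rw [weightFunctional_root hz, zero_smul, sub_zero]
      exact lie_mem_cyclicSpan hneg hz hp
  exact hle hp

theorem fst_mem_bottomSpace (h : IsCascadeStep b β k s)
    {p : L × SymmetricAlgebra ℂ L} (hp : p ∈ pairSpan b X β k s F) :
    p.1 ∈ bottomSpace β (insert k s) := by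
  have hle : pairSpan b X β k s F ≤
      Submodule.comap (LinearMap.fst ℂ L (SymmetricAlgebra ℂ L))
        (bottomSpace β (insert k s)) := by
    refine closureUnder_le ?_ ?_
    · rw [Submodule.span_singleton_le_iff_mem]
      exact Submodule.subset_span ⟨β k,
        h.longOrthogonal.cascadeDegree_self (Finset.mem_insert_self k s), X.v_mem _⟩
    · rintro _ ⟨α, -, hα, z, hz, rfl⟩ p hp
      refine lie_mem_bottomSpace ?_ hz hp
      rw [root_apply_corootSum, hα, Int.cast_zero]
  exact hle hp

/-- `pairSpan` is the graph of a linear map. -/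
theorem eq_zero_of_mem_pairSpan (h : IsCascadeStep b β k s)
    (hF : IsHighestWeightVector b (weightSum β s) F) {n : ℕ}
    (hFn : F ∈ (topSpace β s).map (SymmetricAlgebra.ι ℂ L) ^ n)
    {a : SymmetricAlgebra ℂ L} (ha : (0, a) ∈ pairSpan b X β k s F) : a = 0 := by
  let Y : Submodule ℂ (SymmetricAlgebra ℂ L) :=
    (pairSpan b X β k s F).comap (LinearMap.inr ℂ L (SymmetricAlgebra ℂ L))
  have hmem : ∀ a, a ∈ Y ↔ (0, a) ∈ pairSpan b X β k s F := fun a => Iff.rfl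
  suffices hY : Y = ⊥ by
    have : a ∈ Y := ha
    rwa [hY] at this
  by_contra hY
  have hFU : F ∈ symPow ℂ L L n := map_ι_pow_le_symPow _ n hFn
  have hYU : Y ≤ (symPow ℂ L L n).toSubmodule := fun a ha =>
    map_ι_pow_le_symPow _ n (h.snd_mem_pow hFn ha)
  have : FiniteDimensional ℂ (symPow ℂ L L n).toSubmodule :=
    inferInstanceAs (Module.Finite ℂ (symPow ℂ L L n))
  have : FiniteDimensional ℂ Y := Submodule.finiteDimensional_of_le hYU
  -- `Y` is stable under all positive root vectors of `L`: those of degree zero preserve the span of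
  -- pairs, and those of positive degree kill the symmetric algebra of the degree-two piece. Its
  -- highest weight vector lies in the module generated by `F`, so it is a multiple of `F`.
  obtain ⟨μ, a, haY, ha⟩ := exists_isHighestWeightVector_mem (b := b) hY
    (fun t x hx => by
      have h1 := h.pairAction_mem_pairSpan hF (χ := 0) rfl (mem_rootSpace_of_mem t.2) hx
      rw [pairAction_apply] at h1
      have h2 : ⁅(t : L), x⁆ - weightFunctional β (insert k s) (t : L) • x ∈ Y := by
        simpa [hmem] using h1
      have h3 := add_mem h2 (Y.smul_mem (weightFunctional β (insert k s) (t : L)) hx)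
      rwa [sub_add_cancel] at h3)
    (fun α hα z hz x hx => by
      rcases (h.nonneg α hα).eq_or_lt with h0 | h0
      · have h1 := h.pairAction_mem_pairSpan hF
          (by rw [root_apply_corootSum, ← h0, Int.cast_zero]) hz hx
        rw [pairAction_apply, weightFunctional_root hz] at h1
        simpa [hmem] using h1
      · have h2 : ⁅z, x⁆ = 0 := lie_eq_zero_of_mem_map_ι_pow
          (fun y hy => lie_eq_zero_of_mem_topSpace h.le_two h0 hz hy) (h.snd_mem_pow hFn hx)
        rw [h2]
        exact zero_mem _)
  have hspan := hF.mem_span_of_mem_cyclicSpan hFU ha (snd_mem_cyclicSpan haY)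
  obtain ⟨c, rfl⟩ := Submodule.mem_span_singleton.1 hspan
  have hc : c ≠ 0 := by
    rintro rfl
    exact ha.ne_zero (zero_smul _ _)
  have hFY : F ∈ Y := by
    have := Y.smul_mem c⁻¹ haY
    rwa [smul_smul, inv_mul_cancel₀ hc, one_smul] at this
  obtain ⟨d, hd⟩ := exists_forall_root_apply_eq_height b
  have hcart := h.pairAction_cartan_self (X := X) hF d
  -- `(0, F)` has the same eigenvalue under `d` as the generator, whose eigenspace in the span is a
  -- line; this contradicts `v (β k) ≠ 0`.
  have hspan2 : ((0 : L), F) ∈ Submodule.span ℂ {(X.v (β k), F)} := by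
    refine mem_span_singleton_of_mem_closureUnder hcart ?_ hFY ?_
    · rintro _ ⟨α, hneg, hα, z, hz, rfl⟩
      obtain ⟨m, hm⟩ := height_neg_of_not_isPos hneg
      refine ⟨m, fun p => ?_⟩
      have h3 : ⁅(d : L), z⁆ = α.1 d • z := lie_eq_smul_of_mem_rootSpace hz d
      rw [hd, hm] at h3
      simp only [pairAction_apply, weightFunctional_root hz, zero_smul, sub_zero]
      ext
      · change ⁅(d : L), ⁅z, p.1⁆⁆ = ⁅z, ⁅(d : L), p.1⁆⁆ - ((m : ℂ) + 1) • ⁅z, p.1⁆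
        rw [leibniz_lie, h3, smul_lie, neg_smul]
        abel
      · change ⁅(d : L), ⁅z, p.2⁆⁆ - weightFunctional β (insert k s) (d : L) • ⁅z, p.2⁆ =
          ⁅z, ⁅(d : L), p.2⁆ - weightFunctional β (insert k s) (d : L) • p.2⁆ -
            ((m : ℂ) + 1) • ⁅z, p.2⁆
        have e1 : ⁅z, weightFunctional β (insert k s) (d : L) • p.2⁆ =
          weightFunctional β (insert k s) (d : L) • ⁅z, p.2⁆ := lie_smul _ _ _
        have e2 : ⁅-((m : ℂ) + 1) • z, p.2⁆ = -((m : ℂ) + 1) • ⁅z, p.2⁆ := smul_lie _ _ _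
        rw [leibniz_lie, h3, e2, lie_sub, e1, neg_smul]
        abel
    · have h5 := congrArg Prod.snd hcart
      rw [pairAction_apply] at h5 ⊢
      ext
      · simp
      · exact h5
  obtain ⟨c, hc⟩ := Submodule.mem_span_singleton.1 hspan2
  have h6 : c • X.v (β k) = 0 := congrArg Prod.fst hc
  have h7 : c • F = F := congrArg Prod.snd hc
  have h8 : c = 0 := (smul_eq_zero.1 h6).resolve_right (X.v_ne_zero _)
  rw [h8, zero_smul] at h7
  exact hF.ne_zero h7.symm

/-- There is a linear map from `L` to `S L` that is equivariant, up to a twist, on the root spaces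
of degree minus two and maps the lowest root vector `v (β k)` to `F`. -/
theorem exists_equivariant_linearMap [LieAlgebra.IsSimple ℂ L] (h : IsCascadeStep b β k s)
    (hF : IsHighestWeightVector b (weightSum β s) F) {n : ℕ}
    (hFn : F ∈ (topSpace β s).map (SymmetricAlgebra.ι ℂ L) ^ n) (X : DualRootVectors H) :
    ∃ φ : L →ₗ[ℂ] SymmetricAlgebra ℂ L, φ (X.v (β k)) = F ∧
      (∀ y ∈ bottomSpace β (insert k s),
        φ y ∈ (topSpace β (insert k s)).map (SymmetricAlgebra.ι ℂ L) ^ n) ∧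
      ∀ χ : H → ℂ, χ (corootSum β (insert k s)) = 0 → ∀ z ∈ rootSpace H χ,
        ∀ y ∈ bottomSpace β (insert k s),
          φ ⁅z, y⁆ = ⁅z, φ y⁆ - weightFunctional β (insert k s) z • φ y := by
  obtain ⟨φ, hφ⟩ := exists_linearMap_of_graph
    (N := pairSpan b X β k s F) (fun a ha => h.eq_zero_of_mem_pairSpan hF hFn ha)
  have hsurj : ∀ y ∈ bottomSpace β (insert k s), (y, φ y) ∈ pairSpan b X β k s F := by
    intro y hy
    -- The first components form a nonzero submodule of the irreducible piece of degree minus two,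
    -- hence all of it.
    have h1 : y ∈ (pairSpan b X β k s F).map (LinearMap.fst ℂ L (SymmetricAlgebra ℂ L)) := by
      refine mem_of_mem_bottomSpace h.le_two ?_ ?_ ?_ hy
      · intro h0
        have : X.v (β k) ∈
            (pairSpan b X β k s F).map (LinearMap.fst ℂ L (SymmetricAlgebra ℂ L)) :=
          ⟨_, self_mem_pairSpan, rfl⟩
        rw [h0] at this
        exact X.v_ne_zero _ this
      · rintro _ ⟨p, hp, rfl⟩
        exact h.fst_mem_bottomSpace hp
      · rintro χ hχ z hz _ ⟨p, hp, rfl⟩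
        exact ⟨_, h.pairAction_mem_pairSpan hF hχ hz hp, rfl⟩
    obtain ⟨p, hp, rfl⟩ := h1
    have := hφ p hp
    change (p.1, φ p.1) ∈ _
    rwa [this]
  refine ⟨φ, hφ _ self_mem_pairSpan, fun y hy => h.snd_mem_pow hFn (hsurj y hy),
    fun χ hχ z hz y hy => ?_⟩
  exact hφ _ (h.pairAction_mem_pairSpan hF hχ hz (hsurj y hy))

end IsCascadeStep

end SymLie

/-! ### The contraction as a highest weight vector -/

namespace SymLie

open LieAlgebra LieAlgebra.IsKilling LieModule

variable {L : Type*} [LieRing L] [LieAlgebra ℂ L] [FiniteDimensional ℂ L] [IsKilling ℂ L]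
  {H : LieSubalgebra ℂ L} [H.IsCartanSubalgebra]

/-- A linear map from `L` to `S L` that maps the root spaces of degree minus two to the `n`-th
power of those of degree two, and is equivariant there up to a twist. -/
structure IsTwistedEquivariant (β : ℕ → H.root) (s : Finset ℕ) (n : ℕ)
    (φ : L →ₗ[ℂ] SymmetricAlgebra ℂ L) : Prop where
  map_mem : ∀ y ∈ bottomSpace β s, φ y ∈ (topSpace β s).map (SymmetricAlgebra.ι ℂ L) ^ n
  map_lie : ∀ χ : H → ℂ, χ (corootSum β s) = 0 → ∀ z ∈ rootSpace H χ, ∀ y ∈ bottomSpace β s,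
    φ ⁅z, y⁆ = ⁅z, φ y⁆ - weightFunctional β s z • φ y

/-- The contraction of a linear map `φ : L → S L` with the canonical element of the tensor product
of the spaces of degree two and minus two. -/
noncomputable def contraction (X : DualRootVectors H) (β : ℕ → H.root) (s : Finset ℕ)
    (φ : L →ₗ[ℂ] SymmetricAlgebra ℂ L) : SymmetricAlgebra ℂ L :=
  ∑ γ : {γ : H.root // cascadeDegree (rootSystem H) β s γ = 2},
    SymmetricAlgebra.ι ℂ L (X.u γ) * φ (X.v γ)

variable {β : ℕ → H.root} {s : Finset ℕ} {n : ℕ} {φ : L →ₗ[ℂ] SymmetricAlgebra ℂ L}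

theorem DualRootVectors.u_mem_topSpace (X : DualRootVectors H) {γ : H.root}
    (hγ : cascadeDegree (rootSystem H) β s γ = 2) : X.u γ ∈ topSpace β s :=
  Submodule.subset_span ⟨γ, hγ, X.u_mem γ⟩

theorem DualRootVectors.v_mem_bottomSpace (X : DualRootVectors H) {γ : H.root}
    (hγ : cascadeDegree (rootSystem H) β s γ = 2) : X.v γ ∈ bottomSpace β s :=
  Submodule.subset_span ⟨γ, hγ, X.v_mem γ⟩

theorem DualRootVectors.sum_smul_u (X : DualRootVectors H) {χ : H → ℂ}
    (hχ : χ (corootSum β s) = (2 : ℤ)) {x : L} (hx : x ∈ rootSpace H χ) :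
    ∑ γ : {γ : H.root // cascadeDegree (rootSystem H) β s γ = 2},
      killingForm ℂ L (X.v γ) x • X.u γ = x := by
  rcases eq_zero_or_exists_root_of_degree hx hχ two_ne_zero with rfl | ⟨δ, rfl, hδ⟩
  · simp
  · rw [Finset.sum_eq_single ⟨δ, hδ⟩, ← X.eq_smul_u hx]
    · intro γ _ hγ
      rw [X.killingForm_eq_zero_of_ne hx, zero_smul]
      intro h
      exact hγ (Subtype.ext (Subtype.ext (DFunLike.coe_injective h.symm)))
    · simp

theorem DualRootVectors.sum_smul_v (X : DualRootVectors H) {χ : H → ℂ}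
    (hχ : χ (corootSum β s) = (-2 : ℤ)) {x : L} (hx : x ∈ rootSpace H χ) :
    ∑ γ : {γ : H.root // cascadeDegree (rootSystem H) β s γ = 2},
      killingForm ℂ L (X.u γ) x • X.v γ = x := by
  rcases eq_zero_or_exists_root_of_degree hx hχ (by simp) with rfl | ⟨δ', rfl, hδ'⟩
  · simp
  · obtain ⟨δ, hδ⟩ := exists_coe_eq_neg δ'
    have hδ2 : cascadeDegree (rootSystem H) β s δ = 2 := by
      rw [cascadeDegree_eq_neg_of_coe_eq_neg hδ, hδ', neg_neg]
    rw [← neg_eq_iff_eq_neg] at hδ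
    rw [← hδ] at hx
    rw [Finset.sum_eq_single ⟨δ, hδ2⟩, ← X.eq_smul_v hx]
    · intro γ _ hγ
      rw [killingForm_apply_eq_zero_of_mem_rootSpace_of_add_ne_zero ℂ L H (X.u_mem γ) hx, zero_smul]
      intro h
      rw [← sub_eq_add_neg, sub_eq_zero] at h
      exact hγ (Subtype.ext (Subtype.ext (DFunLike.coe_injective h)))
    · simp

theorem IsTwistedEquivariant.contraction_mem (hφ : IsTwistedEquivariant β s n φ)
    (X : DualRootVectors H) :
    contraction X β s φ ∈ (topSpace β s).map (SymmetricAlgebra.ι ℂ L) ^ (n + 1) := by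
  rw [pow_succ']
  exact sum_mem fun γ _ => Submodule.mul_mem_mul
    (Submodule.mem_map_of_mem (X.u_mem_topSpace γ.2)) (hφ.map_mem _ (X.v_mem_bottomSpace γ.2))

theorem IsTwistedEquivariant.lie_cartan_contraction (hφ : IsTwistedEquivariant β s n φ)
    (X : DualRootVectors H) (t : H) :
    ⁅(t : L), contraction X β s φ⁆ = weightSum β s t • contraction X β s φ := by
  rw [contraction, lie_sum, Finset.smul_sum]
  refine Finset.sum_congr rfl fun γ _ => ?_
  have h1 := hφ.map_lie 0 rfl _ (mem_rootSpace_of_mem t.2) _ (X.v_mem_bottomSpace γ.2)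
  have h2 : ⁅(t : L), X.v γ⁆ = -γ.1.1 t • X.v γ := lie_eq_smul_of_mem_rootSpace (X.v_mem _) t
  have h3 : ⁅(t : L), X.u γ⁆ = γ.1.1 t • X.u γ := lie_eq_smul_of_mem_rootSpace (X.u_mem _) t
  rw [h2, map_smul, weightFunctional_coe, eq_sub_iff_add_eq] at h1
  rw [lie_mul, lie_ι, h3, ← h1, map_smul, smul_mul_assoc, mul_add, mul_smul_comm, mul_smul_comm,
    neg_smul]
  abel

/-- The character vanishes on root vectors, so `φ` commutes with `z`, and the canonical element of
the two dual pieces is invariant under degree zero. -/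
theorem IsTwistedEquivariant.lie_contraction (hφ : IsTwistedEquivariant β s n φ)
    (X : DualRootVectors H) {α : H.root} (hα : cascadeDegree (rootSystem H) β s α = 0) {z : L}
    (hz : z ∈ rootSpace H α.1) : ⁅z, contraction X β s φ⁆ = 0 := by
  have hα' : α.1 (corootSum β s) = 0 := by rw [root_apply_corootSum, hα, Int.cast_zero]
  rw [contraction, lie_sum]
  have h := sum_apply_add_sum_apply_eq_zero
    (e := fun γ : {γ : H.root // cascadeDegree (rootSystem H) β s γ = 2} => X.u γ)
    (e' := fun γ => X.v γ)
    ((LinearMap.mul ℂ (SymmetricAlgebra ℂ L)).compl₁₂ (SymmetricAlgebra.ι ℂ L) φ) z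
    (fun γ => X.sum_smul_u (χ := α.1 + γ.1.1)
      (by rw [Pi.add_apply, hα', root_apply_corootSum, γ.2, zero_add])
      (lie_mem_rootSpace_add hz (X.u_mem _)))
    (fun γ => X.sum_smul_v (χ := α.1 + -γ.1.1)
      (by rw [Pi.add_apply, Pi.neg_apply, hα', root_apply_corootSum, γ.2, zero_add]; simp)
      (lie_mem_rootSpace_add hz (X.v_mem _)))
  rw [← h, ← Finset.sum_add_distrib]
  refine Finset.sum_congr rfl fun γ _ => ?_
  have h1 := hφ.map_lie _ hα' _ hz _ (X.v_mem_bottomSpace γ.2)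
  rw [weightFunctional_root hz, zero_smul, sub_zero] at h1
  rw [lie_mul, lie_ι, ← h1]
  rfl

theorem IsTwistedEquivariant.isHighestWeightVector_contraction
    (hφ : IsTwistedEquivariant β s n φ) {b : (rootSystem H).Base}
    (hd : ∀ γ, cascadeDegree (rootSystem H) β s γ ≤ 2)
    (hb : ∀ α, b.IsPos α → 0 ≤ cascadeDegree (rootSystem H) β s α) (X : DualRootVectors H)
    (h0 : contraction X β s φ ≠ 0) :
    IsHighestWeightVector b (weightSum β s) (contraction X β s φ) where
  ne_zero := h0
  lie_cartan := hφ.lie_cartan_contraction X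
  lie_pos α hα z hz := by
    rcases (hb α hα).eq_or_lt with h | h
    · exact hφ.lie_contraction X h.symm hz
    · exact lie_eq_zero_of_mem_map_ι_pow (fun y hy => lie_eq_zero_of_mem_topSpace hd h hz hy)
        (hφ.contraction_mem X)

/-- The linear factor `u γ` takes the value 1 at the point when `γ` is one of the `β i`, and 0
otherwise. -/
theorem evalAt_contraction (hs : IsLongOrthogonal (rootSystem H) β s) (X : DualRootVectors H)
    (a : SymmetricAlgebra ℂ L →ₐ[ℂ] ℂ)
    (ha : ∀ x, a (SymmetricAlgebra.ι ℂ L x) = killingForm ℂ L (∑ i ∈ s, X.v (β i)) x) :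
    a (contraction X β s φ) = ∑ i ∈ s, a (φ (X.v (β i))) := by
  rw [contraction, map_sum]
  simp only [map_mul, ha, map_sum, LinearMap.sum_apply, Finset.sum_mul]
  rw [Finset.sum_comm]
  refine Finset.sum_congr rfl fun i hi => ?_
  rw [Finset.sum_eq_single ⟨β i, hs.cascadeDegree_self hi⟩, X.killingForm_v_u, one_mul]
  · intro γ _ hγ
    rw [X.killingForm_eq_zero_of_ne (X.u_mem γ), zero_mul]
    intro h
    exact hγ (Subtype.ext (Subtype.ext (DFunLike.coe_injective h)))
  · simp

/-! ### Non-vanishing of the contraction -/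

section Connection

variable (hs : IsLongOrthogonal (rootSystem H) β s)
  (hd : ∀ γ, cascadeDegree (rootSystem H) β s γ ≤ 2) (X : DualRootVectors H)

include hs in
theorem lie_u_v_eq_zero {i l : ℕ} (hi : i ∈ s) (hl : l ∈ s) (hil : i ≠ l) :
    ⁅X.u (β i), X.v (β l)⁆ = 0 := by
  rcases eq_zero_or_mem_or_exists_root (lie_mem_rootSpace_add (X.u_mem (β i)) (X.v_mem (β l))) with
    h | ⟨h, -⟩ | ⟨α, h⟩
  · exact h
  · rw [← sub_eq_add_neg, sub_eq_zero] at h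
    have h1 : β i = β l := Subtype.ext (DFunLike.coe_injective h)
    have h2 := hs.orthogonal i hi l hl hil
    rw [h1] at h2
    simp at h2
  · refine absurd ⟨α, ?_⟩ (hs.root_sub_root_notMem hi hl hil)
    ext t
    have := congrFun h t
    simp only [Pi.add_apply, Pi.neg_apply] at this
    change α.1 t = (β i).1 t - (β l).1 t
    rw [← this]
    ring

include hs hd in
-- Jacobi identity: `v δ` and `v (β l)` commute because their bracket would have degree -4, and `⁅u
-- (β i), v (β l)⁆` vanishes unless `i = l`.
theorem lie_lie_u_v_v {i l : ℕ} (hi : i ∈ s) (hl : l ∈ s) {δ : H.root}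
    (hδ : cascadeDegree (rootSystem H) β s δ = 2) :
    ⁅⁅X.u (β i), X.v δ⁆, X.v (β l)⁆ =
      if i = l then -δ.1 (dualElt (β i).1.toLinear) • X.v δ else 0 := by
  have h1 : ⁅X.v δ, X.v (β l)⁆ = 0 := by
    refine eq_zero_of_two_lt_abs_degree hd (lie_mem_rootSpace_add (X.v_mem δ) (X.v_mem (β l)))
      (m := -4) ?_ (by norm_num)
    rw [Pi.add_apply, Pi.neg_apply, Pi.neg_apply, root_apply_corootSum, root_apply_corootSum, hδ,
      hs.cascadeDegree_self hl]
    norm_num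
  rw [lie_lie, h1, lie_zero, zero_sub]
  split_ifs with h
  · subst h
    rw [X.lie_u_v, lie_skew]
    exact lie_eq_smul_of_mem_rootSpace (X.v_mem δ) _
  · rw [lie_u_v_eq_zero hs X hi hl h, lie_zero, neg_zero]

include hs hd in
theorem lie_lie_u_v_sum {i : ℕ} (hi : i ∈ s) {δ : H.root}
    (hδ : cascadeDegree (rootSystem H) β s δ = 2) :
    ⁅⁅X.u (β i), X.v δ⁆, ∑ l ∈ s, X.v (β l)⁆ = -δ.1 (dualElt (β i).1.toLinear) • X.v δ := by
  rw [lie_sum, Finset.sum_congr rfl fun l hl => lie_lie_u_v_v hs hd X hi hl hδ,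
    Finset.sum_ite_eq, if_pos hi]

theorem apply_dualElt_ne_zero {δ α : H.root} (h : (rootSystem H).pairingIn ℤ δ α = 1) :
    δ.1 (dualElt α.1.toLinear) ≠ 0 := by
  have h1 := two_mul_apply_dualElt δ.1.toLinear α
  simp only [Weight.toLinear_apply] at h1
  rw [← coe_pairingIn, h, Int.cast_one, mul_one] at h1
  intro h0
  rw [h0, mul_zero] at h1
  exact root_apply_dualElt_ne_zero α h1.symm

include hs in
theorem apply_dualElt_eq {i j : ℕ} (hi : i ∈ s) (hj : j ∈ s) {δ : H.root}
    (h1 : (rootSystem H).pairingIn ℤ δ (β i) = 1) (h2 : (rootSystem H).pairingIn ℤ δ (β j) = 1) :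
    δ.1 (dualElt (β i).1.toLinear) = δ.1 (dualElt (β j).1.toLinear) := by
  have key : ∀ α : H.root, 2 * δ.1 (dualElt α.1.toLinear) =
      δ.1 (dualElt δ.1.toLinear) * ((rootSystem H).pairingIn ℤ α δ : ℂ) := by
    intro α
    have h := two_mul_apply_dualElt α.1.toLinear δ
    rw [apply_dualElt_comm] at h
    simp only [Weight.toLinear_apply] at h
    rw [h, coe_pairingIn]
  have h3 := key (β i)
  rw [hs.pairingIn_eq_of_pairingIn_eq_one hi hj h1 h2, ← key] at h3
  exact mul_left_cancel₀ two_ne_zero h3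

include hs hd in
-- The elements `z₁` and `z₂` of degree zero move `E` by the same vector, so `z₁ - z₂` fixes `E`,
-- and `⁅z₁ - z₂, φ Y⁆` vanishes at `E` for every `Y`. With `Y` the vector opposite to the root `β i
-- + β j - δ`, `z₁` and `z₂` send `Y` to the same nonzero multiple of `v (β j)` and of `v (β i)`,
-- and equivariance of `φ` gives the equality.
theorem IsTwistedEquivariant.evalAt_eq (hφ : IsTwistedEquivariant β s n φ) {i j : ℕ} (hi : i ∈ s)
    (hj : j ∈ s) (hij : i ≠ j) {δ : H.root} (hδ : cascadeDegree (rootSystem H) β s δ = 2)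
    (h1 : (rootSystem H).pairingIn ℤ δ (β i) = 1) (h2 : (rootSystem H).pairingIn ℤ δ (β j) = 1) :
    evalAt (∑ l ∈ s, X.v (β l)) (φ (X.v (β i))) = evalAt (∑ l ∈ s, X.v (β l)) (φ (X.v (β j))) := by
  set E := ∑ l ∈ s, X.v (β l) with hE
  set y := X.v δ with hy
  set z₁ := ⁅X.u (β i), y⁆ with hz₁
  set z₂ := ⁅X.u (β j), y⁆ with hz₂
  have hz₁m : z₁ ∈ rootSpace H ((β i).1 + -δ.1 : H → ℂ) :=
    lie_mem_rootSpace_add (X.u_mem _) (X.v_mem _)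
  have hz₂m : z₂ ∈ rootSpace H ((β j).1 + -δ.1 : H → ℂ) :=
    lie_mem_rootSpace_add (X.u_mem _) (X.v_mem _)
  have hzE : ⁅z₁ - z₂, E⁆ = 0 := by
    rw [sub_lie, lie_lie_u_v_sum hs hd X hi hδ, lie_lie_u_v_sum hs hd X hj hδ,
      apply_dualElt_eq hs hi hj h1 h2, sub_self]
  have hdeg : ∀ l ∈ s, ((β l).1 + -δ.1 : H → ℂ) (corootSum β s) = 0 := by
    intro l hl
    rw [Pi.add_apply, Pi.neg_apply, root_apply_corootSum, root_apply_corootSum, hδ,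
      hs.cascadeDegree_self hl]
    ring
  have hne : ∀ l, (rootSystem H).pairingIn ℤ δ (β l) = 1 → ((β l).1 + -δ.1 : H → ℂ) ≠ 0 := by
    intro l hl h
    rw [← sub_eq_add_neg, sub_eq_zero] at h
    have h' : β l = δ := Subtype.ext (DFunLike.coe_injective h)
    rw [h'] at hl
    simp at hl
  have huu : ⁅X.u (β i), X.u (β j)⁆ = 0 := by
    refine eq_zero_of_two_lt_abs_degree hd (lie_mem_rootSpace_add (X.u_mem (β i)) (X.u_mem (β j)))
      (m := 4) ?_ (by norm_num)
    rw [Pi.add_apply, root_apply_corootSum, root_apply_corootSum, hs.cascadeDegree_self hi,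
      hs.cascadeDegree_self hj]
    norm_num
  set w := ⁅X.u (β j), z₁⁆ with hw
  have hw' : w = ⁅X.u (β i), z₂⁆ := by
    rw [hw, hz₁, hz₂, leibniz_lie (X.u (β i)), huu, zero_lie, zero_add]
  -- Up to nonzero scalars, bracketing `w` with `v (β j)` recovers `z₁`, and bracketing `z₁` with `v
  -- (β i)` recovers `v δ`.
  have hw0 : w ≠ 0 := by
    intro h0
    have e1 : ⁅X.v (β j), z₁⁆ = 0 := by
      rw [← lie_skew, lie_lie_u_v_v hs hd X hi hj hδ, if_neg hij, neg_zero]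
    have e2 : ⁅(dualElt (β j).1.toLinear : L), z₁⁆ =
        ((β i).1 + -δ.1 : H → ℂ) (dualElt (β j).1.toLinear) • z₁ :=
      lie_eq_smul_of_mem_rootSpace hz₁m _
    have e3 : (β i).1 (dualElt (β j).1.toLinear) = 0 := by
      have h := two_mul_apply_dualElt (β i).1.toLinear (β j)
      simp only [Weight.toLinear_apply] at h
      rw [← coe_pairingIn, hs.orthogonal i hi j hj hij, Int.cast_zero, mul_zero] at h
      simpa using h
    have e4 : ⁅X.v (β j), w⁆ = δ.1 (dualElt (β j).1.toLinear) • z₁ := by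
      rw [hw, leibniz_lie, e1, lie_zero, add_zero, ← lie_skew (X.v (β j)), X.lie_u_v, neg_lie, e2,
        Pi.add_apply, e3, zero_add, Pi.neg_apply, neg_smul, neg_neg]
    rw [h0, lie_zero, eq_comm, smul_eq_zero] at e4
    have hz0 : z₁ = 0 := e4.resolve_left (apply_dualElt_ne_zero h2)
    have e5 := lie_lie_u_v_v hs hd X hi hi hδ
    rw [if_pos rfl, ← hy, ← hz₁, hz0, zero_lie, eq_comm, smul_eq_zero] at e5
    rcases e5 with e5 | e5
    · exact apply_dualElt_ne_zero h1 (neg_eq_zero.1 e5)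
    · exact X.v_ne_zero δ e5
  have hwm : w ∈ rootSpace H ((β j).1 + ((β i).1 + -δ.1) : H → ℂ) :=
    lie_mem_rootSpace_add (X.u_mem _) hz₁m
  obtain ⟨δ', hδ', hδ'2⟩ := (eq_zero_or_exists_root_of_degree (β := β) (s := s) (m := 2) hwm
    (by rw [Pi.add_apply, hdeg i hi, root_apply_corootSum, hs.cascadeDegree_self hj, add_zero])
    two_ne_zero).resolve_left hw0
  set Y := X.v δ' with hY
  have hA : killingForm ℂ L w Y ≠ 0 := by
    intro h
    rw [hδ'] at hwm
    have h3 := X.eq_smul_u hwm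
    have h4 : killingForm ℂ L (X.v δ') w = killingForm ℂ L w (X.v δ') := traceForm_comm ℂ L L _ _
    rw [h4, h, zero_smul] at h3
    exact hw0 h3
  have hYm : Y ∈ rootSpace H (-((β j).1 + ((β i).1 + -δ.1)) : H → ℂ) := by
    rw [hδ']
    exact X.v_mem δ'
  -- The coefficient is `κ(u (β j), ⁅z₁, Y⁆) = κ(⁅u (β j), z₁⁆, Y)`, with `κ` the Killing form. The
  -- same computation for `z₂` gives the same number because `w = ⁅u (β i), z₂⁆` as well.
  have hY₁ : ⁅z₁, Y⁆ = killingForm ℂ L w Y • X.v (β j) := by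
    have h3 : ⁅z₁, Y⁆ ∈ rootSpace H (-(β j).1 : H → ℂ) := by
      have := lie_mem_rootSpace_add hz₁m hYm
      convert this using 2
      abel
    rw [X.eq_smul_v h3]
    congr 1
    exact (LieModule.traceForm_apply_lie_apply ℂ L L _ _ _).symm
  have hY₂ : ⁅z₂, Y⁆ = killingForm ℂ L w Y • X.v (β i) := by
    have h3 : ⁅z₂, Y⁆ ∈ rootSpace H (-(β i).1 : H → ℂ) := by
      have := lie_mem_rootSpace_add hz₂m hYm
      convert this using 2
      abel
    rw [X.eq_smul_v h3, hw']
    congr 1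
    exact (LieModule.traceForm_apply_lie_apply ℂ L L _ _ _).symm
  have hYb : Y ∈ bottomSpace β s := X.v_mem_bottomSpace hδ'2
  have e1 := hφ.map_lie _ (hdeg i hi) _ hz₁m _ hYb
  have e2 := hφ.map_lie _ (hdeg j hj) _ hz₂m _ hYb
  rw [weightFunctional_of_mem_rootSpace (hne i h1) hz₁m, zero_smul, sub_zero, hY₁, map_smul] at e1
  rw [weightFunctional_of_mem_rootSpace (hne j h2) hz₂m, zero_smul, sub_zero, hY₂, map_smul] at e2
  have e3 := evalAt_lie hzE (φ Y)
  rw [sub_lie, ← e1, ← e2, ← smul_sub, map_smul, smul_eq_mul, map_sub] at e3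
  exact (sub_eq_zero.1 ((mul_eq_zero.1 e3).resolve_left hA)).symm

include hs hd in
/-- A function on `s` that takes equal values at two indices connected by a root of degree two is
constant. -/
theorem eq_of_forall_connected [LieAlgebra.IsSimple ℂ L] {A : Type*} (f : ℕ → A)
    (hf : ∀ i ∈ s, ∀ j ∈ s, ∀ δ, i ≠ j → cascadeDegree (rootSystem H) β s δ = 2 →
      (rootSystem H).pairingIn ℤ δ (β i) = 1 → (rootSystem H).pairingIn ℤ δ (β j) = 1 → f i = f j)
    {i j : ℕ} (hi : i ∈ s) (hj : j ∈ s) : f i = f j := by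
  classical
  obtain ⟨X⟩ : Nonempty (DualRootVectors H) := inferInstance
  -- `I` is a union of connected components, so the sum of its coroots commutes with degree zero,
  -- and its eigenspace for -2 in degree minus two is a submodule. It contains `v (β j)`, so by
  -- irreducibility it contains `v (β i)`, which forces `i ∈ I`.
  let I : Finset ℕ := {l ∈ s | f l = f j}
  have hI : I ⊆ s := Finset.filter_subset _ _
  have hself : ∀ l ∈ s, (β l).1 (corootSum β I) = if l ∈ I then 2 else 0 := by
    intro l hl
    rw [root_apply_corootSum', hs.sum_pairingIn_self hI hl]
    split_ifs <;> simp
  have hzero : ∀ χ : H → ℂ, χ (corootSum β s) = 0 → ∀ z ∈ rootSpace H χ,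
      ⁅(corootSum β I : L), z⁆ = 0 := by
    intro χ hχ z hz
    have h : ⁅(corootSum β I : L), z⁆ = χ (corootSum β I) • z := lie_eq_smul_of_mem_rootSpace hz _
    rcases eq_zero_or_mem_or_exists_root hz with rfl | ⟨rfl, -⟩ | ⟨γ, rfl⟩
    · exact lie_zero _
    · rw [h, Pi.zero_apply, zero_smul]
    · rw [root_apply_corootSum] at hχ
      rw [h, root_apply_corootSum', hs.sum_pairingIn_eq_zero hd (by exact_mod_cast hχ) hI,
        Int.cast_zero, zero_smul]
      intro i hi j hj δ hij hδ h1 h2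
      simp [I, hi, hj, hf i hi j hj δ hij hδ h1 h2]
  have hmem : ∀ l ∈ s, X.v (β l) ∈ bottomSpace β s := fun l hl =>
    X.v_mem_bottomSpace (hs.cascadeDegree_self hl)
  have hlie : ∀ l, ⁅(corootSum β I : L), X.v (β l)⁆ = -(β l).1 (corootSum β I) • X.v (β l) :=
    fun l => lie_eq_smul_of_mem_rootSpace (X.v_mem _) _
  let Y : Submodule ℂ L :=
    bottomSpace β s ⊓ (ad ℂ L (corootSum β I : L)).eigenspace (-2)
  have hY : X.v (β i) ∈ Y := by
    refine mem_of_mem_bottomSpace hd ?_ inf_le_left ?_ (hmem i hi)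
    · have hj' : X.v (β j) ∈ Y := by
        refine ⟨hmem j hj, Module.End.mem_eigenspace_iff.2 ?_⟩
        have hjI : j ∈ I := Finset.mem_filter.2 ⟨hj, rfl⟩
        rw [ad_apply, hlie, hself j hj, if_pos hjI]
      intro (h : Y = ⊥)
      rw [h] at hj'
      exact X.v_ne_zero _ hj'
    · intro χ hχ z hz y hy
      refine ⟨lie_mem_bottomSpace hχ hz hy.1, Module.End.mem_eigenspace_iff.2 ?_⟩
      have h := Module.End.mem_eigenspace_iff.1 hy.2
      rw [ad_apply] at h ⊢
      rw [leibniz_lie, hzero χ hχ z hz, zero_lie, zero_add, h, lie_smul]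
  have h := Module.End.mem_eigenspace_iff.1 hY.2
  rw [ad_apply, hlie, hself i hi] at h
  split_ifs at h with hiI
  · exact (Finset.mem_filter.1 hiI).2
  · rw [neg_zero, zero_smul, eq_comm, smul_eq_zero] at h
    exact absurd (h.resolve_left (by norm_num)) (X.v_ne_zero _)

end Connection

/-- The value of the contraction at the new point is the number of indices times the value of `F` at
the old one. Indeed all terms `φ (v (β i))` have the same value, and adding `v (β k)` to the point
does not change the value of `F`, because `β k` has degree zero for `s` and `F` involves only roots
of degree 2. -/
theorem IsCascadeStep.exists_isHighestWeightVector [LieAlgebra.IsSimple ℂ L]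
    {b : (rootSystem H).Base} {k : ℕ} (h : IsCascadeStep b β k s) (X : DualRootVectors H)
    {F : SymmetricAlgebra ℂ L} (hF : IsHighestWeightVector b (weightSum β s) F)
    (hFn : F ∈ (topSpace β s).map (SymmetricAlgebra.ι ℂ L) ^ n)
    (hF0 : evalAt (∑ i ∈ s, X.v (β i)) F ≠ 0) :
    ∃ F' : SymmetricAlgebra ℂ L, IsHighestWeightVector b (weightSum β (insert k s)) F' ∧
      F' ∈ (topSpace β (insert k s)).map (SymmetricAlgebra.ι ℂ L) ^ (n + 1) ∧
      evalAt (∑ i ∈ insert k s, X.v (β i)) F' ≠ 0 := by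
  have hs := h.longOrthogonal
  have hks := Finset.mem_insert_self k s
  obtain ⟨φ, hφk, hφm, hφl⟩ := h.exists_equivariant_linearMap hF hFn X
  have hφ : IsTwistedEquivariant β (insert k s) n φ := ⟨hφm, hφl⟩
  have hk : evalAt (∑ i ∈ insert k s, X.v (β i)) (φ (X.v (β k))) =
      evalAt (∑ i ∈ s, X.v (β i)) F := by
    rw [hφk]
    refine algHom_eq_of_mem_map_ι_pow (fun x hx => ?_) hFn
    rw [evalAt_ι, evalAt_ι, Finset.sum_insert h.notMem, map_add, LinearMap.add_apply,
      add_eq_right]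
    induction hx using Submodule.span_induction with
    | mem x hx =>
      obtain ⟨γ, hγ, hx⟩ := hx
      refine X.killingForm_eq_zero_of_ne hx fun heq => ?_
      have h1 : γ = β k := Subtype.ext (DFunLike.coe_injective heq)
      rw [h1, cascadeDegree, hs.sum_pairingIn_self (Finset.subset_insert k s) hks,
        if_neg h.notMem] at hγ
      exact absurd hγ (by norm_num)
    | zero => exact map_zero _
    | add x y _ _ hx hy => rw [map_add, hx, hy, add_zero]
    | smul c x _ hx => rw [map_smul, hx, smul_zero]
  have h0 : evalAt (∑ i ∈ insert k s, X.v (β i)) (contraction X β (insert k s) φ) ≠ 0 := by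
    rw [evalAt_contraction hs X _ (evalAt_ι _), Finset.sum_congr rfl fun i hi =>
      eq_of_forall_connected hs h.le_two
        (fun i => evalAt (∑ l ∈ insert k s, X.v (β l)) (φ (X.v (β i))))
        (fun i hi j hj δ hij hδ h1 h2 => hφ.evalAt_eq hs h.le_two X hi hj hij hδ h1 h2) hi hks,
      Finset.sum_const, hk, nsmul_eq_mul]
    refine mul_ne_zero (Nat.cast_ne_zero.2 ?_) hF0
    exact (Finset.card_pos.2 ⟨k, hks⟩).ne'
  refine ⟨_, hφ.isHighestWeightVector_contraction h.le_two h.nonneg X fun h' => h0 ?_,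
    hφ.contraction_mem X, h0⟩
  rw [h', map_zero]

end SymLie

namespace SymLie

open LieAlgebra LieAlgebra.IsKilling LieModule

/-! ### Induction along the cascade -/

section Cascade

variable {L : Type*} [LieRing L] [LieAlgebra ℂ L] [FiniteDimensional ℂ L]
  [LieAlgebra.IsSimple ℂ L] {H : LieSubalgebra ℂ L} [H.IsCartanSubalgebra]
  {b : (rootSystem H).Base} {k : ℕ} {β : ℕ → H.root}

theorem isLongOrthogonal_Icc (hβ₁ : IsHighestRoot b (β 1))
    (hβ : ∀ i, 1 ≤ i → i < k →
      IsHighestLongRootOrthogonalTo b (β '' Set.Icc 1 i) (β (i + 1)))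
    (hσ : IsDominant b ((rootSystem H).root (β 1))) :
    IsLongOrthogonal (rootSystem H) β (Finset.Icc 1 k) where
  long := by
    intro i hi
    obtain ⟨h1, hk⟩ := Finset.mem_Icc.1 hi
    obtain rfl | h := h1.eq_or_lt
    · refine hβ₁.isLongRoot fun i hi => ?_
      obtain ⟨n, hn⟩ := hσ i hi
      have : (rootSystem H).pairingIn ℤ (β 1) i = n := by
        apply FaithfulSMul.algebraMap_injective ℤ ℂ
        rw [(rootSystem H).root_coroot_eq_pairing] at hn
        simpa [intCast_pairingIn] using hn
      rw [this]
      positivity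
    · obtain ⟨j, rfl⟩ : ∃ j, i = j + 1 := ⟨i - 1, by lia⟩
      exact (hβ j (by lia) (by lia)).1
  orthogonal := by
    have key : ∀ i j, 1 ≤ i → i < j → j ≤ k → (rootSystem H).IsOrthogonal (β j) (β i) := by
      intro i j hi hij hj
      obtain ⟨j, rfl⟩ : ∃ l, j = l + 1 := ⟨j - 1, by lia⟩
      exact (hβ j (by lia) (by lia)).2.1 _ ⟨i, ⟨hi, by lia⟩, rfl⟩
    intro i hi j hj hij
    rw [Finset.mem_Icc] at hi hj
    rcases lt_or_gt_of_ne hij with h | h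
    · exact IsOrthogonal.pairingIn_eq_zero (key i j hi.1 h hj.2).symm
    · exact IsOrthogonal.pairingIn_eq_zero (key j i hj.1 h hi.2)

theorem exists_isHighestWeightVector_Icc (hβ₁ : IsHighestRoot b (β 1))
    (hs : IsLongOrthogonal (rootSystem H) β (Finset.Icc 1 k))
    (hσ : ∀ i, 1 ≤ i → i ≤ k →
      IsDominant b (∑ j ∈ Finset.Icc 1 i, (rootSystem H).root (β j)))
    (X : DualRootVectors H) {j : ℕ} (hj : j ≤ k) :
    ∃ F : SymmetricAlgebra ℂ L, IsHighestWeightVector b (weightSum β (Finset.Icc 1 j)) F ∧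
      F ∈ (topSpace β (Finset.Icc 1 j)).map (SymmetricAlgebra.ι ℂ L) ^ j ∧
      evalAt (∑ i ∈ Finset.Icc 1 j, X.v (β i)) F ≠ 0 := by
  induction j with
  | zero =>
    -- The induction starts from the empty set of roots, with the constant 1 of weight zero. The
    -- nonzero value at the sum of the `v (β i)` is carried along because the next step needs it.
    have h1 : evalAt (∑ i ∈ Finset.Icc 1 0, X.v (β i)) 1 ≠ 0 := by simp
    refine ⟨1, ⟨fun h => h1 (by rw [h, map_zero]), fun t => ?_, fun _ _ x _ => lie_one x⟩,
      by rw [pow_zero]; exact Submodule.one_le.1 le_rfl, h1⟩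
    rw [lie_one]
    simp [weightSum]
  | succ j ih =>
    obtain ⟨F, hF, hFn, hF0⟩ := ih (by lia)
    have hins : Finset.Icc 1 (j + 1) = insert (j + 1) (Finset.Icc 1 j) := by
      ext i
      simp only [Finset.mem_Icc, Finset.mem_insert]
      lia
    have hnonneg : ∀ i ≤ k, ∀ α, b.IsPos α →
        0 ≤ cascadeDegree (rootSystem H) β (Finset.Icc 1 i) α := by
      intro i hi α hα
      rcases Nat.eq_zero_or_pos i with rfl | hi0
      · simp [cascadeDegree]
      · exact (hs.mono (Finset.Icc_subset_Icc_right hi)).cascadeDegree_nonneg (hσ i hi0 hi) hα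
    have hs' := hs.mono (Finset.Icc_subset_Icc_right hj)
    have hstep : IsCascadeStep b β (j + 1) (Finset.Icc 1 j) := by
      refine ⟨by simp, hins ▸ hs', hins ▸ fun γ => ?_, hins ▸ hnonneg _ hj, hnonneg j (by lia)⟩
      exact hs'.cascadeDegree_le_two (Finset.mem_Icc.2 ⟨le_rfl, by lia⟩) hβ₁
        (fun α hα => hnonneg _ hj α (b.isPos_of_mem_support hα)) γ
    rw [hins]
    exact hstep.exists_isHighestWeightVector X hF hFn hF0

end Cascade

end SymLie

theorem proposition6p1 {L : Type*} [LieRing L] [LieAlgebra ℂ L] [FiniteDimensional ℂ L]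
    [LieAlgebra.IsSimple ℂ L] (H : LieSubalgebra ℂ L) [H.IsCartanSubalgebra]
    (b : (LieAlgebra.IsKilling.rootSystem H).Base)
    (k : ℕ) (hk : 1 ≤ k) (β : ℕ → H.root)
    (hβ₁ : SymLie.IsHighestRoot b (β 1))
    (hβ : ∀ i, 1 ≤ i → i < k →
      SymLie.IsHighestLongRootOrthogonalTo b (β '' Set.Icc 1 i) (β (i + 1)))
    (hσ : ∀ i, 1 ≤ i → i ≤ k →
      SymLie.IsDominant b (∑ j ∈ Finset.Icc 1 i, (LieAlgebra.IsKilling.rootSystem H).root (β j))) :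
    ∃ W : LieSubmodule ℂ L (SymmetricAlgebra ℂ L), W ≤ SymLie.symPow ℂ L L k ∧
      SymLie.IsIrreducibleWithHighestWeight b W
        (∑ j ∈ Finset.Icc 1 k, (LieAlgebra.IsKilling.rootSystem H).root (β j)) := by
  open SymLie in
  obtain ⟨X⟩ : Nonempty (DualRootVectors H) := inferInstance
  have hs := isLongOrthogonal_Icc hβ₁ hβ (by simpa using hσ 1 le_rfl hk)
  obtain ⟨F, hF, hFk, -⟩ := exists_isHighestWeightVector_Icc hβ₁ hs hσ X le_rfl
  exact hF.exists_isIrreducibleWithHighestWeight (map_ι_pow_le_symPow _ k hFk)
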